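/- Let $M$ be a smooth (Hausdorff, second countable) manifold of dimension $2n+1$, $n\ge 0$. An almost contact metric structure $(\phi,\xi,\eta,g)$ on $M$ consists of a smooth $(1,1)$-tensor field $\phi$, a smooth vector field $\xi$, a smooth $1$-form $\eta$ and a Riemannian metric $g$ such that, for all vector fields $X,Y$, $$\phi^2X=-X+\eta(X)\xi,\quad \phi\xi=0,\quad \eta\circ\phi=0,\quad \eta(\xi)=1,\quad g(\phi X,\phi Y)=g(X,Y)-\eta(X)\eta(Y),\quad \eta(X)=g(\xi,X).$$ It is a contact metric structure if $\eta\wedge(d\eta)^n\neq0$ everywhere and $d\eta(X,Y)=g(X,\phi Y)$, where $d\eta(X,Y)=\tfrac12\big(X\eta(Y)-Y\eta(X)-\eta([X,Y])\big)$. It is normal if the almost complex structure $\bar J$ on $M\times\mathbb R$ given by $\bar JX=\phi X-\eta(X)\frac{\partial}{\partial t}$, $\bar J\frac{\partial}{\partial t}=\xi$ is integrable, i.e. its Nijenhuis torsion vanishes, and it is Sasakian if it is a normal contact metric structure. Let $\nabla$ be the Levi-Civita connection of $g$, $R(X,Y)Z=[\nabla_X,\nabla_Y]Z-\nabla_{[X,Y]}Z$,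 $R(X,Y,Z,W)=g(R(X,Y)Z,W)$, and $\Phi(X,Y)=g(\phi X,Y)$. Consider the following identities, each required for all smooth vector fields $X,Y,Z,W$ on $M$: $$(G_1)\quad R(X,Y,Z,W)-R(X,Y,\phi Z,\phi W)=g(X,W)g(Y,Z)-g(Y,W)g(X,Z)-\Phi(X,W)\Phi(Y,Z)+\Phi(Y,W)\Phi(X,Z);$$ $$(G_2)\quad R(X,Y,Z,W)-R(\phi X,\phi Y,Z,W)-R(\phi X,Y,\phi Z,W)-R(\phi X,Y,Z,\phi W)=g(Y,Z)\eta(X)\eta(W)-g(Y,W)\eta(X)\eta(Z);$$ $$(G_3)\quad R(X,Y,Z,W)-R(\phi X,\phi Y,\phi Z,\phi W)=g(X,W)\eta(Y)\eta(Z)+g(Y,Z)\eta(X)\eta(W)-g(X,Z)\eta(Y)\eta(W)-g(Y,W)\eta(X)\eta(Z).$$ If $(\phi,\xi,\eta,g)$ is a contact metric structure on $M$ that satisfies at least one of $(G_1)$, $(G_2)$, $(G_3)$, then it is Sasakian. -/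

import Mathlib

open Set Bundle VectorField
open scoped Manifold ContDiff

noncomputable section

namespace ContactGeometry

/-! ### Vector fields on a manifold -/

section General

variable {E : Type*} [NormedAddCommGroup E] [NormedSpace ℝ E]
  {H : Type*} [TopologicalSpace H] (I : ModelWithCorners ℝ E H)
  {M : Type*} [TopologicalSpace M] [ChartedSpace H M] [IsManifold I ∞ M]

/-- `X` is a smooth vector field on `M`. -/
def IsSmoothField (X : ∀ x : M, TangentSpace I x) : Prop :=
  ContMDiff I I.tangent ∞ (fun x ↦ (⟨x, X x⟩ : TangentBundle I M))

/-- The Nijenhuis torsion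
`[J, J](X, Y) = J²[X, Y] + [JX, JY] - J[JX, Y] - J[X, JY]` of a `(1,1)`-tensor field `J`. -/
def nijenhuis (J : ∀ x : M, TangentSpace I x →L[ℝ] TangentSpace I x)
    (X Y : ∀ x : M, TangentSpace I x) (x : M) : TangentSpace I x :=
  J x (J x (mlieBracket I X Y x))
    + mlieBracket I (fun y ↦ J y (X y)) (fun y ↦ J y (Y y)) x
    - J x (mlieBracket I (fun y ↦ J y (X y)) Y x)
    - J x (mlieBracket I X (fun y ↦ J y (Y y)) x)

/-- An almost complex structure `J` is integrable: its Nijenhuis torsion vanishes. -/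
def IsIntegrable (J : ∀ x : M, TangentSpace I x →L[ℝ] TangentSpace I x) : Prop :=
  ∀ X Y : ∀ x : M, TangentSpace I x, IsSmoothField I X → IsSmoothField I Y →
    ∀ x, nijenhuis I J X Y x = 0

/-- The exterior derivative of a 1-form, with the normalization
`2 dη(X, Y) = X(η(Y)) - Y(η(X)) - η([X, Y])` used in contact metric geometry. -/
def dForm (η : ∀ x : M, TangentSpace I x →L[ℝ] ℝ)
    (X Y : ∀ x : M, TangentSpace I x) (x : M) : ℝ :=
  (1 / 2 : ℝ) * (mvfderiv I (fun y ↦ η y (Y y)) x (X x)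
    - mvfderiv I (fun y ↦ η y (X y)) x (Y x)
    - η x (mlieBracket I X Y x))

end General

/-! ### The Levi-Civita connection and the curvature tensor -/

section Riemannian

variable {E : Type*} [NormedAddCommGroup E] [NormedSpace ℝ E] [FiniteDimensional ℝ E]
  {H : Type*} [TopologicalSpace H] {I : ModelWithCorners ℝ E H}
  {M : Type*} [TopologicalSpace M] [ChartedSpace H M] [IsManifold I ∞ M]
  (g : ContMDiffRiemannianMetric I ∞ E (fun x : M ↦ TangentSpace I x))

/-- The right-hand side of the Koszul formula for `2 g(∇_X Y, Z)`. -/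
def koszul (X Y Z : ∀ x : M, TangentSpace I x) (x : M) : ℝ :=
  mvfderiv I (fun y ↦ g.inner y (Y y) (Z y)) x (X x)
    + mvfderiv I (fun y ↦ g.inner y (Z y) (X y)) x (Y x)
    - mvfderiv I (fun y ↦ g.inner y (X y) (Y y)) x (Z x)
    + g.inner x (mlieBracket I X Y x) (Z x)
    - g.inner x (mlieBracket I Y Z x) (X x)
    + g.inner x (mlieBracket I Z X x) (Y x)

/-- `v` satisfies the Koszul formula for `∇_X Y` at `x`, tested against all vector fields that are
differentiable at `x`. -/
def IsKoszulVector (X Y : ∀ x : M, TangentSpace I x) (x : M) (v : TangentSpace I x) : Prop :=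
  ∀ Z : ∀ x : M, TangentSpace I x,
    MDifferentiableAt I I.tangent (fun y ↦ (⟨y, Z y⟩ : TangentBundle I M)) x →
      2 * g.inner x v (Z x) = koszul g X Y Z x

theorem mdiff_inner {X Y : ∀ x : M, TangentSpace I x} {x : M} (hX : MDiffAt (T% X) x)
    (hY : MDiffAt (T% Y) x) : MDiffAt (fun y ↦ g.inner y (X y) (Y y)) x := by
  let : RiemannianBundle (fun x : M ↦ TangentSpace I x) := ⟨g.toRiemannianMetric⟩
  have : IsContMDiffRiemannianBundle I 1 E (fun x : M ↦ TangentSpace I x) :=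
    .of_le (n := ∞) (by simp)
  exact MDifferentiableAt.inner_bundle (IB := I) (F := E) (E := fun x : M ↦ TangentSpace I x) hX hY

theorem koszul_tensorial {X Y : ∀ x : M, TangentSpace I x} {x : M} (hX : MDiffAt (T% X) x)
    (hY : MDiffAt (T% Y) x) :
    TensorialAt I E (fun Z ↦ koszul g X Y Z x) x where
  smul := by
    intro f Z hf hZ
    have : IsManifold I 2 M := inferInstance
    have e1 : (fun y ↦ g.inner y (Y y) ((f • Z) y)) = f * (fun y ↦ g.inner y (Y y) (Z y)) := by
      ext y; simp
    have e2 : (fun y ↦ g.inner y ((f • Z) y) (X y)) = f * (fun y ↦ g.inner y (Z y) (X y)) := by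
      ext y; simp
    simp only [koszul, e1, e2]
    rw [mvfderiv_mul hf (mdiff_inner g hY hZ), mvfderiv_mul hf (mdiff_inner g hZ hX),
      mlieBracket_smul_right hf hZ, mlieBracket_smul_left hf hZ]
    simp [g.symm x (Y x) (Z x)]
    ring
  add := by
    intro Z Z' hZ hZ'
    have : IsManifold I 2 M := inferInstance
    have e1 : (fun y ↦ g.inner y (Y y) ((Z + Z') y)) = (fun y ↦ g.inner y (Y y) (Z y)) + (fun y ↦ g.inner y (Y y) (Z' y)) := by
      ext y; simp
    have e2 : (fun y ↦ g.inner y ((Z + Z') y) (X y)) = (fun y ↦ g.inner y (Z y) (X y)) + (fun y ↦ g.inner y (Z' y) (X y)):= by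
      ext y; simp
    simp only [koszul, e1, e2]
    rw [mvfderiv_add (mdiff_inner g hY hZ) (mdiff_inner g hY hZ'), mvfderiv_add (mdiff_inner g hZ hX) (mdiff_inner g hZ' hX),
      mlieBracket_add_right hZ hZ', mlieBracket_add_left hZ hZ']
    simp
    ring

/-- The Koszul formula determines a vector: the connection below is well defined. -/
theorem exists_koszulVector {X Y : ∀ x : M, TangentSpace I x} {x : M} (hX : MDiffAt (T% X) x)
    (hY : MDiffAt (T% Y) x) : ∃ v : TangentSpace I x, IsKoszulVector g X Y x v := by
  have : IsManifold I 1 M := inferInstance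
  have : FiniteDimensional ℝ (TangentSpace I x) := inferInstanceAs (FiniteDimensional ℝ E)
  let ℓ := TensorialAt.mkHom _ x (koszul_tensorial g hX hY)
  let B : TangentSpace I x →ₗ[ℝ] Module.Dual ℝ (TangentSpace I x) :=
    { toFun := fun v ↦ (g.inner x v).toLinearMap
      map_add' := by intros; ext; simp
      map_smul' := by intros; ext; simp }
  have hB : Function.Injective B := by
    rw [injective_iff_map_eq_zero]
    intro v hv
    by_contra hne
    have h1 := g.pos x v hne
    have h2 : g.inner x v v = 0 := congrArg (fun L ↦ L v) hv
    linarith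
  have hs : Function.Surjective B :=
    (LinearMap.injective_iff_surjective_of_finrank_eq_finrank
      (Subspace.dual_finrank_eq).symm).1 hB
  obtain ⟨v, hv⟩ := hs ((1 / 2 : ℝ) • ℓ.toLinearMap)
  refine ⟨v, fun Z hZ ↦ ?_⟩
  have h1 : g.inner x v (Z x) = (1 / 2 : ℝ) * ℓ (Z x) := congrArg (fun L ↦ L (Z x)) hv
  have h2 : ℓ (Z x) = koszul g X Y Z x := TensorialAt.mkHom_apply (koszul_tensorial g hX hY) hZ
  rw [h1, h2]; ring

open Classical in
/-- The Levi-Civita connection `∇_X Y` of `g`, given by the Koszul formula. -/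
def leviCivita (X Y : ∀ x : M, TangentSpace I x) (x : M) : TangentSpace I x :=
  if h : ∃ v : TangentSpace I x, IsKoszulVector g X Y x v then h.choose else 0

theorem leviCivita_spec {X Y : ∀ x : M, TangentSpace I x} {x : M} (hX : MDiffAt (T% X) x)
    (hY : MDiffAt (T% Y) x) : IsKoszulVector g X Y x (leviCivita g X Y x) := by
  have h := exists_koszulVector g hX hY
  rw [leviCivita, dif_pos h]
  exact h.choose_spec

/-- The connection is metric. -/
theorem leviCivita_metric {X Y Z : ∀ x : M, TangentSpace I x} {x : M} (hX : MDiffAt (T% X) x)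
    (hY : MDiffAt (T% Y) x) (hZ : MDiffAt (T% Z) x) :
    mvfderiv I (fun y ↦ g.inner y (Y y) (Z y)) x (X x)
      = g.inner x (leviCivita g X Y x) (Z x) + g.inner x (Y x) (leviCivita g X Z x) := by
  have h1 := leviCivita_spec g hX hY Z hZ
  have h2 := leviCivita_spec g hX hZ Y hY
  rw [g.symm x (Y x)]
  have e (A B : ∀ x : M, TangentSpace I x) :
    (fun y ↦ g.inner y (A y) (B y)) = fun y ↦ g.inner y (B y) (A y) := by
      ext y; exact g.symm _ _ _
  rw [koszul] at h1 h2
  rw [e Z Y, e Y X, mlieBracket_swap_apply (V := X) (W := Z), mlieBracket_swap_apply (V := Z) (W := Y),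
    mlieBracket_swap_apply (V := Y) (W := X), e X Z] at h2
  simp only [map_neg, neg_apply] at h2
  linarith

/-- The connection is torsion-free. -/
theorem leviCivita_torsion_free {X Y : ∀ x : M, TangentSpace I x} {x : M}
    (hX : MDiffAt (T% X) x) (hY : MDiffAt (T% Y) x) :
    leviCivita g X Y x - leviCivita g Y X x = mlieBracket I X Y x := by
  have : IsManifold I 1 M := inferInstance
  have key : ∀ w : TangentSpace I x,
      g.inner x (leviCivita g X Y x - leviCivita g Y X x - mlieBracket I X Y x) w = 0 := by
    intro w
    have hZ := FiberBundle.mdifferentiableAt_extend I E (V := fun x : M ↦ TangentSpace I x) w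
    have h1 := leviCivita_spec g hX hY _ hZ
    have h2 := leviCivita_spec g hY hX _ hZ
    have hw : FiberBundle.extend E (E := fun x : M ↦ TangentSpace I x) w x = w := by simp
    set Z := FiberBundle.extend E (E := fun x : M ↦ TangentSpace I x) w
    have e (A B : ∀ x : M, TangentSpace I x) :
      (fun y ↦ g.inner y (A y) (B y)) = fun y ↦ g.inner y (B y) (A y) := by
        ext y; exact g.symm _ _ _
    rw [koszul] at h1 h2
    rw [e X Z, e Z Y, e Y X, mlieBracket_swap_apply (V := X) (W := Z), mlieBracket_swap_apply (V := Z) (W := Y),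
      mlieBracket_swap_apply (V := Y) (W := X)] at h2
    simp only [map_neg, neg_apply, hw] at h1 h2
    simp only [map_sub, sub_apply]
    linarith
  by_contra hne
  exact (g.pos x _ (sub_ne_zero.2 hne)).ne' (key _)
/-- `R(X, Y)Z = ∇_X ∇_Y Z - ∇_Y ∇_X Z - ∇_{[X, Y]} Z`. -/
def curvature (X Y Z : ∀ x : M, TangentSpace I x) (x : M) : TangentSpace I x :=
  leviCivita g X (leviCivita g Y Z) x - leviCivita g Y (leviCivita g X Z) x
    - leviCivita g (mlieBracket I X Y) Z x

/-- `R(X, Y, Z, W) = g(R(X, Y)Z, W)`. -/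
def curvature₄ (X Y Z W : ∀ x : M, TangentSpace I x) (x : M) : ℝ :=
  g.inner x (curvature g X Y Z x) (W x)

end Riemannian

/-! ### Almost contact metric structures -/

/-- An almost contact metric structure `(φ, ξ, η, g)` on a smooth manifold of dimension `2n+1`. -/
structure AlmostContactMetric (n : ℕ) (M : Type*) [TopologicalSpace M]
    [ChartedSpace (EuclideanSpace ℝ (Fin (2 * n + 1))) M] [IsManifold (𝓡 (2 * n + 1)) ∞ M] where
  /-- the `(1,1)`-tensor field `φ` -/
  φ : ∀ x : M, TangentSpace (𝓡 (2 * n + 1)) x →L[ℝ] TangentSpace (𝓡 (2 * n + 1)) x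
  /-- the vector field `ξ` -/
  ξ : ∀ x : M, TangentSpace (𝓡 (2 * n + 1)) x
  /-- the 1-form `η` -/
  η : ∀ x : M, TangentSpace (𝓡 (2 * n + 1)) x →L[ℝ] ℝ
  /-- the Riemannian metric `g` -/
  g : ContMDiffRiemannianMetric (𝓡 (2 * n + 1)) ∞ (EuclideanSpace ℝ (Fin (2 * n + 1)))
    (fun x : M ↦ TangentSpace (𝓡 (2 * n + 1)) x)
  smooth_φ : ContMDiff (𝓡 (2 * n + 1)) ((𝓡 (2 * n + 1)).prod
      𝓘(ℝ, EuclideanSpace ℝ (Fin (2 * n + 1)) →L[ℝ] EuclideanSpace ℝ (Fin (2 * n + 1)))) ∞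
    (fun x : M ↦ TotalSpace.mk'
      (EuclideanSpace ℝ (Fin (2 * n + 1)) →L[ℝ] EuclideanSpace ℝ (Fin (2 * n + 1)))
      (E := fun x : M ↦ TangentSpace (𝓡 (2 * n + 1)) x →L[ℝ] TangentSpace (𝓡 (2 * n + 1)) x)
      x (φ x))
  smooth_ξ : IsSmoothField (𝓡 (2 * n + 1)) ξ
  smooth_η : ContMDiff (𝓡 (2 * n + 1)) ((𝓡 (2 * n + 1)).prod
      𝓘(ℝ, EuclideanSpace ℝ (Fin (2 * n + 1)) →L[ℝ] ℝ)) ∞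
    (fun x : M ↦ TotalSpace.mk' (EuclideanSpace ℝ (Fin (2 * n + 1)) →L[ℝ] ℝ)
      (E := fun x : M ↦ TangentSpace (𝓡 (2 * n + 1)) x →L[ℝ] ℝ) x (η x))
  φ_φ : ∀ (x : M) (v : TangentSpace (𝓡 (2 * n + 1)) x), φ x (φ x v) = -v + η x v • ξ x
  φ_ξ : ∀ x : M, φ x (ξ x) = 0
  η_φ : ∀ (x : M) (v : TangentSpace (𝓡 (2 * n + 1)) x), η x (φ x v) = 0
  η_ξ : ∀ x : M, η x (ξ x) = 1
  g_φ_φ : ∀ (x : M) (v w : TangentSpace (𝓡 (2 * n + 1)) x),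
    g.inner x (φ x v) (φ x w) = g.inner x v w - η x v * η x w
  η_eq : ∀ (x : M) (v : TangentSpace (𝓡 (2 * n + 1)) x), η x v = g.inner x (ξ x) v

section Contact

variable {n : ℕ} {M : Type*} [TopologicalSpace M]
  [ChartedSpace (EuclideanSpace ℝ (Fin (2 * n + 1))) M] [IsManifold (𝓡 (2 * n + 1)) ∞ M]

/-- Up to a nonzero constant factor, the value of the `(2n+1)`-form `η ∧ (dη)ⁿ` on the vector
fields `V 0, …, V (2n)`. -/
def wedgePower (η : ∀ x : M, TangentSpace (𝓡 (2 * n + 1)) x →L[ℝ] ℝ)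
    (V : Fin (2 * n + 1) → ∀ x : M, TangentSpace (𝓡 (2 * n + 1)) x) (x : M) : ℝ :=
  ∑ σ : Equiv.Perm (Fin (2 * n + 1)), ((Equiv.Perm.sign σ : ℤ) : ℝ) *
    (η x (V (σ 0) x) * ∏ i : Fin n,
      dForm (𝓡 (2 * n + 1)) η (V (σ ⟨2 * i + 1, by omega⟩)) (V (σ ⟨2 * i + 2, by omega⟩)) x)

/-- `η` is a contact form: `η ∧ (dη)ⁿ ≠ 0` everywhere. -/
def IsContactForm (η : ∀ x : M, TangentSpace (𝓡 (2 * n + 1)) x →L[ℝ] ℝ) : Prop :=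
  ∀ x : M, ∃ V : Fin (2 * n + 1) → ∀ x : M, TangentSpace (𝓡 (2 * n + 1)) x,
    (∀ i, IsSmoothField (𝓡 (2 * n + 1)) (V i)) ∧ wedgePower η V x ≠ 0

namespace AlmostContactMetric

variable (S : AlmostContactMetric n M)

/-- The vector field `φX`. -/
def φField (X : ∀ x : M, TangentSpace (𝓡 (2 * n + 1)) x) (x : M) :
    TangentSpace (𝓡 (2 * n + 1)) x :=
  S.φ x (X x)

/-- The structure is a contact metric structure: `η` is a contact form, and
`dη(X, Y) = g(X, φY)`. -/
def IsContactMetric : Prop :=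
  IsContactForm S.η ∧
    ∀ X Y : ∀ x : M, TangentSpace (𝓡 (2 * n + 1)) x,
      IsSmoothField (𝓡 (2 * n + 1)) X → IsSmoothField (𝓡 (2 * n + 1)) Y →
        ∀ x, dForm (𝓡 (2 * n + 1)) S.η X Y x = S.g.inner x (X x) (S.φField Y x)

/-- The almost complex structure `J` on `M × ℝ` given by `JX = φX - η(X) ∂/∂t` and `J ∂/∂t = ξ`,
that is, `J(X + a ∂/∂t) = (φX + a ξ) - η(X) ∂/∂t`. -/
def coneJ (p : M × ℝ) : TangentSpace ((𝓡 (2 * n + 1)).prod 𝓘(ℝ, ℝ)) p →L[ℝ]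
    TangentSpace ((𝓡 (2 * n + 1)).prod 𝓘(ℝ, ℝ)) p :=
  let pr₁ : TangentSpace ((𝓡 (2 * n + 1)).prod 𝓘(ℝ, ℝ)) p →L[ℝ]
      TangentSpace (𝓡 (2 * n + 1)) p.1 :=
    ContinuousLinearMap.fst ℝ (TangentSpace (𝓡 (2 * n + 1)) p.1) ℝ
  let pr₂ : TangentSpace ((𝓡 (2 * n + 1)).prod 𝓘(ℝ, ℝ)) p →L[ℝ] ℝ :=
    ContinuousLinearMap.snd ℝ (TangentSpace (𝓡 (2 * n + 1)) p.1) ℝ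
  ((S.φ p.1).comp pr₁ + pr₂.smulRight (S.ξ p.1)).prod (-(S.η p.1).comp pr₁)

/-- The structure is normal: the almost complex structure `J` on `M × ℝ` is integrable. -/
def IsNormal : Prop :=
  IsIntegrable ((𝓡 (2 * n + 1)).prod 𝓘(ℝ, ℝ)) S.coneJ

/-- A Sasakian structure is a normal contact metric structure. -/
def IsSasakian : Prop :=
  S.IsContactMetric ∧ S.IsNormal

/-- The function `g(X, Y)`. -/
def gFun (X Y : ∀ x : M, TangentSpace (𝓡 (2 * n + 1)) x) (x : M) : ℝ :=
  S.g.inner x (X x) (Y x)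

/-- The function `η(X)`. -/
def ηFun (X : ∀ x : M, TangentSpace (𝓡 (2 * n + 1)) x) (x : M) : ℝ :=
  S.η x (X x)

/-- The function `Φ(X, Y) = g(φX, Y)`; in components, `φ_{ij} = g(φ ∂_i, ∂_j)`. -/
def ΦFun (X Y : ∀ x : M, TangentSpace (𝓡 (2 * n + 1)) x) (x : M) : ℝ :=
  S.g.inner x (S.φField X x) (Y x)

/-- The identity `(G₁)`:
`R_{ijkl} - φ_k^c φ_l^d R_{ijcd} = g_{il} g_{jk} - g_{jl} g_{ik} - φ_{il} φ_{jk} + φ_{jl} φ_{ik}`. -/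
def SatisfiesG₁ : Prop :=
  ∀ X Y Z W : ∀ x : M, TangentSpace (𝓡 (2 * n + 1)) x,
    IsSmoothField (𝓡 (2 * n + 1)) X → IsSmoothField (𝓡 (2 * n + 1)) Y →
    IsSmoothField (𝓡 (2 * n + 1)) Z → IsSmoothField (𝓡 (2 * n + 1)) W → ∀ x,
      curvature₄ S.g X Y Z W x - curvature₄ S.g X Y (S.φField Z) (S.φField W) x
        = S.gFun X W x * S.gFun Y Z x - S.gFun Y W x * S.gFun X Z x
          - S.ΦFun X W x * S.ΦFun Y Z x + S.ΦFun Y W x * S.ΦFun X Z x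

/-- The identity `(G₂)`:
`R_{ijkl} - φ_i^a φ_j^b R_{abkl} - φ_i^a φ_k^c R_{ajcl} - φ_i^a φ_l^d R_{ajkd}
  = g_{jk} η_i η_l - g_{jl} η_i η_k`. -/
def SatisfiesG₂ : Prop :=
  ∀ X Y Z W : ∀ x : M, TangentSpace (𝓡 (2 * n + 1)) x,
    IsSmoothField (𝓡 (2 * n + 1)) X → IsSmoothField (𝓡 (2 * n + 1)) Y →
    IsSmoothField (𝓡 (2 * n + 1)) Z → IsSmoothField (𝓡 (2 * n + 1)) W → ∀ x,
      curvature₄ S.g X Y Z W x - curvature₄ S.g (S.φField X) (S.φField Y) Z W x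
          - curvature₄ S.g (S.φField X) Y (S.φField Z) W x
          - curvature₄ S.g (S.φField X) Y Z (S.φField W) x
        = S.gFun Y Z x * S.ηFun X x * S.ηFun W x - S.gFun Y W x * S.ηFun X x * S.ηFun Z x

/-- The identity `(G₃)`:
`R_{ijkl} - φ_i^a φ_j^b φ_k^c φ_l^d R_{abcd}
  = g_{il} η_j η_k + g_{jk} η_i η_l - g_{ik} η_j η_l - g_{jl} η_i η_k`. -/
def SatisfiesG₃ : Prop :=
  ∀ X Y Z W : ∀ x : M, TangentSpace (𝓡 (2 * n + 1)) x,
    IsSmoothField (𝓡 (2 * n + 1)) X → IsSmoothField (𝓡 (2 * n + 1)) Y →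
    IsSmoothField (𝓡 (2 * n + 1)) Z → IsSmoothField (𝓡 (2 * n + 1)) W → ∀ x,
      curvature₄ S.g X Y Z W x
          - curvature₄ S.g (S.φField X) (S.φField Y) (S.φField Z) (S.φField W) x
        = S.gFun X W x * S.ηFun Y x * S.ηFun Z x + S.gFun Y Z x * S.ηFun X x * S.ηFun W x
          - S.gFun X Z x * S.ηFun Y x * S.ηFun W x - S.gFun Y W x * S.ηFun X x * S.ηFun Z x

end AlmostContactMetric

end Contact

end ContactGeometry

end

noncomputable section

namespace ContactGeometry

/-! ### Calculus of smooth vector fields -/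

section Fields

variable {E : Type*} [NormedAddCommGroup E] [NormedSpace ℝ E]
  {H : Type*} [TopologicalSpace H] {I : ModelWithCorners ℝ E H}
  {M : Type*} [TopologicalSpace M] [ChartedSpace H M] [IsManifold I ∞ M]
  {X Y Z : ∀ x : M, TangentSpace I x} {f : M → ℝ}

/-! Write B v = ∇_v ξ (`nablaξ`). The contact condition fixes the skew part of B, so that B + φ is
symmetric, while d(dη) = 0 makes the cyclic sum of g((∇_u φ)v, w) vanish (`cyclic_inner_covφ`).
Together with φ² = -1 + η ⊗ ξ this yields Bξ = 0, ∇_ξ φ = 0 and Bφ + φB = -2φ² (`nablaξ_φ`), and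
then R(ξ, φX)ξ + φR(ξ, X)ξ = 2φB²X (`curvature_ξ_φField_ξ`).

Because φξ = 0, each of the three identities, tested on X = Z = ξ, gives R(ξ, Y)ξ = η(Y)ξ - Y. Hence
B² = φ², so the symmetric operator B + φ has square zero and must vanish: B = -φ (`nablaξ_eq`).

Once B = -φ, one has R(X, Y, ξ, W) = g((∇_W φ)X, Y) (`curvature₄_ξ_eq`), so the values of R(X, Y)ξ
determine ∇φ. For (G₁) and (G₃) the case Z = ξ gives (∇_v φ)w = g(w, v)ξ - η(w)v at once. For (G₂)
it gives only a linear relation; the defect D of that formula then satisfies D(φw, φv) = 2D(w, v),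
and two applications force D = 4D, so D = 0 (`SatisfiesG₂.covφ_eq`).

Finally the Nijenhuis torsion on M × ℝ is a tensor, so lifted fields and ∂/∂t suffice to test it.
Rewriting brackets through the torsion-free connection reduces its vanishing to the formulas for ∇φ
and ∇ξ (`isNormal_of_covφ`).

Curvature is only ever evaluated with third entry ξ or 0, so no smoothness of a general ∇_X Y is
needed, only that of ∇_X ξ (`isSmoothField_nablaξField`). -/

theorem IsSmoothField.mdiffAt (hX : IsSmoothField I X) (x : M) : MDiffAt (T% X) x :=
  ContMDiff.mdifferentiableAt hX (by simp)

theorem IsSmoothField.add (hX : IsSmoothField I X) (hY : IsSmoothField I Y) :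
    IsSmoothField I (X + Y) :=
  ContMDiff.add_section hX hY

theorem IsSmoothField.sub (hX : IsSmoothField I X) (hY : IsSmoothField I Y) :
    IsSmoothField I (X - Y) :=
  ContMDiff.sub_section hX hY

theorem IsSmoothField.neg (hX : IsSmoothField I X) : IsSmoothField I (-X) :=
  ContMDiff.neg_section hX

theorem IsSmoothField.smul (hf : ContMDiff I 𝓘(ℝ, ℝ) ∞ f) (hX : IsSmoothField I X) :
    IsSmoothField I (f • X) :=
  ContMDiff.smul_section hf hX

theorem IsSmoothField.mlieBracket [CompleteSpace E] (hX : IsSmoothField I X)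
    (hY : IsSmoothField I Y) : IsSmoothField I (mlieBracket I X Y) := by
  have : IsManifold I (((⊤ : ℕ∞) : WithTop ℕ∞) + 1) M := by simpa using ‹IsManifold I ∞ M›
  have : IsManifold I (minSmoothness ℝ 2) M := by simpa using (inferInstance : IsManifold I 2 M)
  intro x
  exact ContMDiffAt.mlieBracket_vectorField (m := (⊤ : ℕ∞)) (n := (⊤ : ℕ∞)) (hX x) (hY x) (by simp)

theorem isSmoothField_zero : IsSmoothField I (0 : ∀ x : M, TangentSpace I x) :=
  Bundle.contMDiff_zeroSection ℝ (TangentSpace I : M → Type _)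

/-- The derivative of a smooth function along a smooth vector field is smooth. -/
theorem IsSmoothField.mvfderiv (hX : IsSmoothField I X) (hf : ContMDiff I 𝓘(ℝ, ℝ) ∞ f) :
    ContMDiff I 𝓘(ℝ, ℝ) ∞ (fun x ↦ mvfderiv I f x (X x)) := by
  have h := (hf.contMDiff_tangentMap (m := ∞) (by simp)).comp hX
  exact (contMDiff_snd_tangentBundle_modelSpace ℝ 𝓘(ℝ, ℝ)).comp h

/-- Every tangent vector extends to a smooth vector field. -/
theorem exists_isSmoothField [FiniteDimensional ℝ E] [T2Space M] (x : M) (v : TangentSpace I x) :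
    ∃ X : ∀ x : M, TangentSpace I x, IsSmoothField I X ∧ X x = v := by
  obtain ⟨s, hs, h⟩ := FiberBundle.exists_contMDiffOn_extend (k := ∞) I E
    (V := fun x : M ↦ TangentSpace I x) v
  obtain ⟨f, -, hf⟩ := (SmoothBumpFunction.nhds_basis_tsupport (I := I) x).mem_iff.1
    (interior_mem_nhds.2 hs)
  refine ⟨(f : M → ℝ) • FiberBundle.extend E v, ?_, ?_⟩
  · exact ContMDiffOn.smul_section_of_tsupport f.contMDiff.contMDiffOn isOpen_interior hf
      (h.mono interior_subset)
  · simp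

/-- The Jacobi identity, for smooth vector fields. -/
theorem mlieBracket_jacobi [CompleteSpace E] (hX : IsSmoothField I X) (hY : IsSmoothField I Y)
    (hZ : IsSmoothField I Z) (x : M) :
    mlieBracket I X (mlieBracket I Y Z) x =
      mlieBracket I (mlieBracket I X Y) Z x + mlieBracket I Y (mlieBracket I X Z) x := by
  have : IsManifold I (minSmoothness ℝ 3) M := by simpa using (inferInstance : IsManifold I 3 M)
  have h2 : minSmoothness ℝ 2 ≤ ∞ := by
    simpa using (ENat.LEInfty.out : (2 : WithTop ℕ∞) ≤ ∞)
  exact leibniz_identity_mlieBracket_apply ((hX x).of_le h2) ((hY x).of_le h2) ((hZ x).of_le h2)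

/-- The Jacobi identity for X, Y, fZ, minus f times the one for X, Y, Z, leaves a multiple of Z
whose coefficient is the difference of the two sides. A field Z that is nonzero at the point lets
the coefficient be read off. -/
theorem mvfderiv_mlieBracket_of_ne_zero [CompleteSpace E] (hX : IsSmoothField I X) (hY : IsSmoothField I Y)
    (hf : ContMDiff I 𝓘(ℝ, ℝ) ∞ f) (hZ : IsSmoothField I Z) {x : M} (hx : Z x ≠ 0) :
    mvfderiv I f x (mlieBracket I X Y x) =
      mvfderiv I (fun y ↦ mvfderiv I f y (Y y)) x (X x)
        - mvfderiv I (fun y ↦ mvfderiv I f y (X y)) x (Y x) := by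
  have hd (g : M → ℝ) (hg : ContMDiff I 𝓘(ℝ, ℝ) ∞ g) (y : M) : MDiffAt g y :=
    hg.mdifferentiableAt (by simp)
  have : IsManifold I 2 M := inferInstance
  have step (U : ∀ x : M, TangentSpace I x) : mlieBracket I U (f • Z)
      = (fun y ↦ mvfderiv I f y (U y)) • Z + f • mlieBracket I U Z := by
    ext y
    exact mlieBracket_smul_right (hd f hf y) (hZ.mdiffAt y)
  have step₂ (U V : ∀ x : M, TangentSpace I x) (hU : IsSmoothField I U) (hV : IsSmoothField I V) :
      mlieBracket I U (mlieBracket I V (f • Z)) x =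
      mvfderiv I (fun y ↦ mvfderiv I f y (V y)) x (U x) • Z x
        + mvfderiv I f x (V x) • mlieBracket I U Z x
        + (mvfderiv I f x (U x) • mlieBracket I V Z x
          + f x • mlieBracket I U (mlieBracket I V Z) x) := by
    have hVf := hV.mvfderiv hf
    rw [step, mlieBracket_add_right ((hZ.smul hVf).mdiffAt x) (((hV.mlieBracket hZ).smul hf).mdiffAt x),
      mlieBracket_smul_right (hd _ hVf x) (hZ.mdiffAt x),
      mlieBracket_smul_right (hd f hf x) ((hV.mlieBracket hZ).mdiffAt x)]
  have key := mlieBracket_jacobi hX hY (hZ.smul hf) x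
  rw [step₂ X Y hX hY, step₂ Y X hY hX, step (mlieBracket I X Y), mlieBracket_jacobi hX hY hZ] at key
  simp only [Pi.add_apply, Pi.smul_apply'] at key
  rw [← sub_eq_zero] at key
  have key' : (mvfderiv I (fun y ↦ mvfderiv I f y (Y y)) x (X x)
      - mvfderiv I (fun y ↦ mvfderiv I f y (X y)) x (Y x)
      - mvfderiv I f x (mlieBracket I X Y x)) • Z x = 0 := by
    rw [← key]
    module
  have := (smul_eq_zero.1 key').resolve_right hx
  linarith

/-- The Lie bracket acts on functions as the commutator of derivations. -/
theorem mvfderiv_mlieBracket [CompleteSpace E] (hX : IsSmoothField I X) (hY : IsSmoothField I Y)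
    (hf : ContMDiff I 𝓘(ℝ, ℝ) ∞ f) (x : M) :
    mvfderiv I f x (mlieBracket I X Y x) =
      mvfderiv I (fun y ↦ mvfderiv I f y (Y y)) x (X x)
        - mvfderiv I (fun y ↦ mvfderiv I f y (X y)) x (Y x) := by
  -- The auxiliary field is whichever of X, Y, [X, Y] is nonzero at the point; if all three vanish
  -- there, both sides are zero.
  by_cases h1 : X x = 0
  · by_cases h2 : Y x = 0
    · by_cases h3 : mlieBracket I X Y x = 0
      · simp [h1, h2, h3]
      · exact mvfderiv_mlieBracket_of_ne_zero hX hY hf (hX.mlieBracket hY) h3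
    · exact mvfderiv_mlieBracket_of_ne_zero hX hY hf hY h2
  · exact mvfderiv_mlieBracket_of_ne_zero hX hY hf hX h1

end Fields

/-! ### Tangent vectors as derivations -/

section Separation

variable {E : Type*} [NormedAddCommGroup E] [NormedSpace ℝ E] [FiniteDimensional ℝ E]
  {H : Type*} [TopologicalSpace H] {I : ModelWithCorners ℝ E H}
  {M : Type*} [TopologicalSpace M] [ChartedSpace H M] [IsManifold I ∞ M] [T2Space M]

/-- Smooth functions separate tangent vectors. -/
theorem eq_zero_of_mvfderiv_eq_zero {x : M} {v : TangentSpace I x}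
    (h : ∀ f : M → ℝ, ContMDiff I 𝓘(ℝ, ℝ) ∞ f → mvfderiv I f x v = 0) : v = 0 := by
  have : IsManifold I 1 M := inferInstance
  obtain ⟨ρ⟩ : Nonempty (SmoothBumpFunction I x) := inferInstance
  have hmd : MDifferentiableAt I 𝓘(ℝ, E) (extChartAt I x) x :=
    mdifferentiableAt_extChartAt (mem_chart_source H x)
  have hinj : mfderiv I 𝓘(ℝ, E) (extChartAt I x) x v = 0 := by
    set w : E := mfderiv I 𝓘(ℝ, E) (extChartAt I x) x v with hw
    change w = 0
    by_contra hne
    obtain ⟨ℓ, hℓ⟩ := SeparatingDual.exists_ne_zero (R := ℝ) hne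
    have hsm : ContMDiffOn I 𝓘(ℝ, ℝ) ∞ (fun y ↦ ℓ (extChartAt I x y)) (chartAt H x).source :=
      ℓ.contMDiff.comp_contMDiffOn contMDiffOn_extChartAt
    have h0 := h _ (ρ.contMDiff_smul hsm)
    -- The bump function makes a linear coordinate ℓ globally smooth without changing its germ at x.
    have heq : (fun y ↦ ρ y • ℓ (extChartAt I x y)) =ᶠ[nhds x] ℓ ∘ extChartAt I x := by
      filter_upwards [ρ.eventuallyEq_one] with y hy
      simp [hy]
    rw [mvfderiv, ContinuousLinearMap.comp_apply, heq.mfderiv_eq,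
      mfderiv_comp x ℓ.mdifferentiableAt hmd] at h0
    apply hℓ
    rw [ContinuousLinearMap.mfderiv_eq] at h0
    exact h0
  have hinv := isInvertible_mfderiv_extChartAt (I := I) (mem_extChartAt_source (I := I) x)
  exact hinv.injective (by rw [hinj, map_zero])

end Separation

/-! ### The Levi-Civita connection as a covariant derivative -/

section Connection

variable {E : Type*} [NormedAddCommGroup E] [NormedSpace ℝ E]
  {H : Type*} [TopologicalSpace H] {I : ModelWithCorners ℝ E H}
  {M : Type*} [TopologicalSpace M] [ChartedSpace H M] [IsManifold I ∞ M]
  (g : ContMDiffRiemannianMetric I ∞ E (fun x : M ↦ TangentSpace I x))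

theorem eq_of_inner_eq {x : M} {u v : TangentSpace I x}
    (h : ∀ w : TangentSpace I x, g.inner x u w = g.inner x v w) : u = v := by
  by_contra hne
  refine (g.pos x _ (sub_ne_zero.2 hne)).ne' ?_
  have h' := h (u - v)
  simp only [map_sub, sub_apply] at h' ⊢
  linarith

theorem eq_zero_of_inner_self {x : M} {u : TangentSpace I x} (h : g.inner x u u = 0) : u = 0 := by
  by_contra hne
  exact (g.pos x _ hne).ne' h

theorem IsSmoothField.inner {X Y : ∀ x : M, TangentSpace I x} (hX : IsSmoothField I X)
    (hY : IsSmoothField I Y) : ContMDiff I 𝓘(ℝ, ℝ) ∞ (fun y ↦ g.inner y (X y) (Y y)) := by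
  let : RiemannianBundle (fun x : M ↦ TangentSpace I x) := ⟨g.toRiemannianMetric⟩
  exact ContMDiff.inner_bundle (IB := I) (F := E) (E := fun x : M ↦ TangentSpace I x) hX hY

variable {X Y Z : ∀ x : M, TangentSpace I x} {x : M}

theorem mdiffAt_extend (v : TangentSpace I x) :
    MDiffAt (T% (FiberBundle.extend E (E := fun x : M ↦ TangentSpace I x) v)) x :=
  have : IsManifold I 1 M := inferInstance
  FiberBundle.mdifferentiableAt_extend I E (V := fun x : M ↦ TangentSpace I x) v

variable [FiniteDimensional ℝ E]

/-- Metric compatibility expresses g(∇_X Y, W) as X(g(Y, W)) - g(Y, ∇_X W), and both terms are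
additive in Y. The Leibniz rule below has the same source. -/
theorem leviCivita_add_right (hX : MDiffAt (T% X) x) (hY : MDiffAt (T% Y) x)
    (hZ : MDiffAt (T% Z) x) :
    leviCivita g X (Y + Z) x = leviCivita g X Y x + leviCivita g X Z x := by
  refine eq_of_inner_eq g fun w ↦ ?_
  have hW := mdiffAt_extend w
  have hw : FiberBundle.extend E (E := fun x : M ↦ TangentSpace I x) w x = w := by simp
  set W := FiberBundle.extend E (E := fun x : M ↦ TangentSpace I x) w
  have h1 := leviCivita_metric g hX (mdifferentiableAt_add_section hY hZ) hW
  have h2 := leviCivita_metric g hX hY hW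
  have h3 := leviCivita_metric g hX hZ hW
  have e : (fun y ↦ g.inner y ((Y + Z) y) (W y))
      = (fun y ↦ g.inner y (Y y) (W y)) + fun y ↦ g.inner y (Z y) (W y) := by
    ext y; simp
  rw [e, mvfderiv_add (mdiff_inner g hY hW) (mdiff_inner g hZ hW)] at h1
  simp only [Pi.add_apply, map_add, add_apply, hw] at h1 h2 h3 ⊢
  linarith

theorem leviCivita_smul_right {f : M → ℝ} (hf : MDiffAt f x) (hX : MDiffAt (T% X) x)
    (hY : MDiffAt (T% Y) x) :
    leviCivita g X (f • Y) x = mvfderiv I f x (X x) • Y x + f x • leviCivita g X Y x := by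
  refine eq_of_inner_eq g fun w ↦ ?_
  have hW := mdiffAt_extend w
  have hw : FiberBundle.extend E (E := fun x : M ↦ TangentSpace I x) w x = w := by simp
  set W := FiberBundle.extend E (E := fun x : M ↦ TangentSpace I x) w
  have h1 := leviCivita_metric g hX (hf.smul_section hY) hW
  have h2 := leviCivita_metric g hX hY hW
  have e : (fun y ↦ g.inner y ((f • Y) y) (W y)) = f * fun y ↦ g.inner y (Y y) (W y) := by
    ext y; simp
  rw [e, mvfderiv_mul hf (mdiff_inner g hY hW)] at h1
  simp only [Pi.smul_apply', map_add, map_smul, add_apply, smul_apply, hw, smul_eq_mul] at h1 h2 ⊢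
  rw [h2] at h1
  linarith

/-- Torsion-freeness turns ∇_X Y into ∇_Y X + [X, Y]; the derivatives of f produced by the Leibniz
rules of the two summands cancel. -/
theorem leviCivita_tensorialAt (hY : MDiffAt (T% Y) x) :
    TensorialAt I E (fun X ↦ leviCivita g X Y x) x where
  smul := by
    intro f X hf hX
    have : IsManifold I 2 M := inferInstance
    rw [sub_eq_iff_eq_add.1 (leviCivita_torsion_free g (hf.smul_section hX) hY),
      leviCivita_smul_right g hf hY hX, mlieBracket_smul_left hf hX,
      ← leviCivita_torsion_free g hX hY]
    module
  add := by
    intro X X' hX hX'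
    have : IsManifold I 2 M := inferInstance
    rw [sub_eq_iff_eq_add.1 (leviCivita_torsion_free g (mdifferentiableAt_add_section hX hX') hY),
      leviCivita_add_right g hY hX hX', mlieBracket_add_left hX hX',
      ← leviCivita_torsion_free g hX hY, ← leviCivita_torsion_free g hX' hY]
    module

open Classical in
/-- The covariant derivative `v ↦ ∇_v Y` at `x` for the Levi-Civita connection of `g`. -/
def nabla (Y : ∀ x : M, TangentSpace I x) (x : M) : TangentSpace I x →L[ℝ] TangentSpace I x :=
  have : IsManifold I 1 M := inferInstance
  if h : MDiffAt (T% Y) x then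
    TensorialAt.mkHom (fun X ↦ leviCivita g X Y x) x (leviCivita_tensorialAt g h)
  else 0

theorem leviCivita_eq_nabla (hX : MDiffAt (T% X) x) (hY : MDiffAt (T% Y) x) :
    leviCivita g X Y x = nabla g Y x (X x) := by
  rw [nabla, dif_pos hY]
  exact (TensorialAt.mkHom_apply (leviCivita_tensorialAt g hY) hX).symm

theorem nabla_add (hY : MDiffAt (T% Y) x) (hZ : MDiffAt (T% Z) x) (v : TangentSpace I x) :
    nabla g (Y + Z) x v = nabla g Y x v + nabla g Z x v := by
  have hv := mdiffAt_extend v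
  have h := leviCivita_add_right g hv hY hZ
  rw [leviCivita_eq_nabla g hv (mdifferentiableAt_add_section hY hZ), leviCivita_eq_nabla g hv hY,
    leviCivita_eq_nabla g hv hZ] at h
  simpa using h

theorem nabla_smul {f : M → ℝ} (hf : MDiffAt f x) (hY : MDiffAt (T% Y) x) (v : TangentSpace I x) :
    nabla g (f • Y) x v = mvfderiv I f x v • Y x + f x • nabla g Y x v := by
  have hv := mdiffAt_extend v
  have h := leviCivita_smul_right g hf hv hY
  rw [leviCivita_eq_nabla g hv (hf.smul_section hY), leviCivita_eq_nabla g hv hY] at h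
  simpa using h

theorem nabla_const_smul (c : ℝ) (hY : MDiffAt (T% Y) x) (v : TangentSpace I x) :
    nabla g (c • Y) x v = c • nabla g Y x v := by
  have h := nabla_smul g (f := fun _ ↦ c) mdifferentiableAt_const hY v
  rw [mvfderiv_const] at h
  simpa using! h

theorem nabla_neg (hY : MDiffAt (T% Y) x) (v : TangentSpace I x) :
    nabla g (-Y) x v = -nabla g Y x v := by
  simpa using nabla_const_smul g (-1) hY v

theorem nabla_zero (v : TangentSpace I x) :
    nabla g (0 : ∀ x : M, TangentSpace I x) x v = 0 := by
  simpa using nabla_const_smul g 0 (isSmoothField_zero.mdiffAt x) v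

theorem mvfderiv_inner (hY : MDiffAt (T% Y) x) (hZ : MDiffAt (T% Z) x) (v : TangentSpace I x) :
    mvfderiv I (fun y ↦ g.inner y (Y y) (Z y)) x v
      = g.inner x (nabla g Y x v) (Z x) + g.inner x (Y x) (nabla g Z x v) := by
  have hv := mdiffAt_extend v
  have h := leviCivita_metric g hv hY hZ
  rw [leviCivita_eq_nabla g hv hY, leviCivita_eq_nabla g hv hZ] at h
  simpa using h

theorem nabla_sub_nabla (hX : MDiffAt (T% X) x) (hY : MDiffAt (T% Y) x) :
    nabla g Y x (X x) - nabla g X x (Y x) = mlieBracket I X Y x := by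
  rw [← leviCivita_torsion_free g hX hY, leviCivita_eq_nabla g hX hY, leviCivita_eq_nabla g hY hX]

end Connection

/-- `X` is a vector field that is differentiable at `x`. -/
abbrev MDiffField {E : Type*} [NormedAddCommGroup E] [NormedSpace ℝ E] {H : Type*}
    [TopologicalSpace H] (I : ModelWithCorners ℝ E H) {M : Type*} [TopologicalSpace M]
    [ChartedSpace H M] [IsManifold I ∞ M] (X : ∀ x : M, TangentSpace I x) (x : M) : Prop :=
  MDifferentiableAt I I.tangent (fun y ↦ (⟨y, X y⟩ : TangentBundle I M)) x

namespace AlmostContactMetric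

variable {n : ℕ} {M : Type*} [TopologicalSpace M]
  [ChartedSpace (EuclideanSpace ℝ (Fin (2 * n + 1))) M] [IsManifold (𝓡 (2 * n + 1)) ∞ M]
  (S : AlmostContactMetric n M)

/-! ### Almost contact metric structures -/

section Almost

variable {X Y Z W : ∀ x : M, TangentSpace (𝓡 (2 * n + 1)) x} {x : M}

/-- Apply the compatibility of g and φ to v and φw: φ²w = -w + η(w)ξ, and both η ∘ φ and g(φv, ξ)
vanish. -/
theorem inner_φ_left (v w : TangentSpace (𝓡 (2 * n + 1)) x) :
    S.g.inner x (S.φ x v) w = -S.g.inner x v (S.φ x w) := by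
  have h := S.g_φ_φ x v (S.φ x w)
  have h0 : S.g.inner x (S.φ x v) (S.ξ x) = 0 := by
    rw [S.g.symm, ← S.η_eq, S.η_φ]
  rw [S.φ_φ, S.η_φ, map_add, map_neg, map_smul, h0] at h
  simp only [smul_eq_mul, mul_zero, add_zero, sub_zero] at h
  linarith

theorem isSmoothField_φField (hX : IsSmoothField (𝓡 (2 * n + 1)) X) :
    IsSmoothField (𝓡 (2 * n + 1)) (S.φField X) :=
  ContMDiff.clm_bundle_apply S.smooth_φ hX

theorem mdiffAt_φField (hX : MDiffField (𝓡 (2 * n + 1)) X x) : MDiffField (𝓡 (2 * n + 1)) (S.φField X) x :=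
  MDifferentiableAt.clm_bundle_apply (S.smooth_φ.mdifferentiableAt (by simp)) hX

theorem ηFun_eq_inner : S.ηFun X = fun y ↦ S.g.inner y (S.ξ y) (X y) := by
  ext y
  exact S.η_eq y _

theorem contMDiff_ηFun (hX : IsSmoothField (𝓡 (2 * n + 1)) X) :
    ContMDiff (𝓡 (2 * n + 1)) 𝓘(ℝ, ℝ) ∞ (S.ηFun X) := by
  rw [S.ηFun_eq_inner]
  exact S.smooth_ξ.inner S.g hX

theorem mdiffAt_ηFun (hX : MDiffField (𝓡 (2 * n + 1)) X x) : MDifferentiableAt (𝓡 (2 * n + 1)) 𝓘(ℝ, ℝ) (S.ηFun X) x := by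
  rw [S.ηFun_eq_inner]
  exact mdiff_inner S.g (S.smooth_ξ.mdiffAt x) hX

theorem inner_ξ_ξ (x : M) : S.g.inner x (S.ξ x) (S.ξ x) = 1 := by
  rw [← S.η_eq, S.η_ξ]

/-- The endomorphism `v ↦ ∇_v ξ`. -/
def nablaξ (x : M) : TangentSpace (𝓡 (2 * n + 1)) x →L[ℝ] TangentSpace (𝓡 (2 * n + 1)) x :=
  nabla S.g S.ξ x

/-- Differentiate g(ξ, ξ) = 1. -/
theorem η_nablaξ (v : TangentSpace (𝓡 (2 * n + 1)) x) : S.η x (S.nablaξ x v) = 0 := by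
  have h := mvfderiv_inner S.g (S.smooth_ξ.mdiffAt x) (S.smooth_ξ.mdiffAt x) v
  simp only [S.inner_ξ_ξ] at h
  rw [mvfderiv_const, S.g.symm x _ (S.ξ x), ← S.η_eq, zero_apply] at h
  change 0 = S.η x (S.nablaξ x v) + S.η x (S.nablaξ x v) at h
  linarith

theorem inner_nablaξ_ξ (v : TangentSpace (𝓡 (2 * n + 1)) x) :
    S.g.inner x (S.nablaξ x v) (S.ξ x) = 0 := by
  rw [S.g.symm, ← S.η_eq, S.η_nablaξ]

theorem mvfderiv_ηFun (hX : MDiffField (𝓡 (2 * n + 1)) X x) (v : TangentSpace (𝓡 (2 * n + 1)) x) :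
    mvfderiv (𝓡 (2 * n + 1)) (S.ηFun X) x v
      = S.g.inner x (S.nablaξ x v) (X x) + S.η x (nabla S.g X x v) := by
  rw [S.ηFun_eq_inner, mvfderiv_inner S.g (S.smooth_ξ.mdiffAt x) hX, S.η_eq]
  rfl

theorem φField_φField : S.φField (S.φField X) = -X + S.ηFun X • S.ξ := by
  ext y
  exact S.φ_φ y _

/-- In ∇(φX) - φ(∇X) the derivative of a scalar factor of X cancels; this is what makes ∇φ a tensor.
-/
theorem φ_tensorialAt : TensorialAt (𝓡 (2 * n + 1)) (EuclideanSpace ℝ (Fin (2 * n + 1)))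
    (fun X ↦ nabla S.g (S.φField X) x - S.φ x ∘L nabla S.g X x) x where
  smul := by
    intro f X hf hX
    have e : S.φField (f • X) = f • S.φField X := by
      ext y; simp [φField]
    ext1 v
    simp only [sub_apply, smul_apply, ContinuousLinearMap.comp_apply]
    rw [e, nabla_smul S.g hf (S.mdiffAt_φField hX), nabla_smul S.g hf hX]
    simp only [map_add, map_smul, φField]
    module
  add := by
    intro X Y hX hY
    have e : S.φField (X + Y) = S.φField X + S.φField Y := by
      ext y; simp [φField]
    ext1 v
    simp only [sub_apply, add_apply, ContinuousLinearMap.comp_apply]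
    rw [e, nabla_add S.g (S.mdiffAt_φField hX) (S.mdiffAt_φField hY), nabla_add S.g hX hY]
    simp only [map_add]
    module

/-- The covariant derivative of `φ`: `covφ x w v = (∇_v φ) w`. -/
def covφ (x : M) : TangentSpace (𝓡 (2 * n + 1)) x →L[ℝ]
    TangentSpace (𝓡 (2 * n + 1)) x →L[ℝ] TangentSpace (𝓡 (2 * n + 1)) x :=
  have : IsManifold (𝓡 (2 * n + 1)) 1 M := inferInstance
  TensorialAt.mkHom _ x (S.φ_tensorialAt (x := x))

theorem nabla_φField (hX : MDiffField (𝓡 (2 * n + 1)) X x) (v : TangentSpace (𝓡 (2 * n + 1)) x) :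
    nabla S.g (S.φField X) x v = S.covφ x (X x) v + S.φ x (nabla S.g X x v) := by
  have h : S.covφ x (X x) = nabla S.g (S.φField X) x - S.φ x ∘L nabla S.g X x :=
    TensorialAt.mkHom_apply (S.φ_tensorialAt (x := x)) hX
  rw [h]
  simp

theorem exists_mdiffAt (v : TangentSpace (𝓡 (2 * n + 1)) x) :
    ∃ X : ∀ x : M, TangentSpace (𝓡 (2 * n + 1)) x, MDiffField (𝓡 (2 * n + 1)) X x ∧ X x = v :=
  ⟨_, mdiffAt_extend v, by simp⟩

/-- Covariant derivative of the skewness of φ. -/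
theorem inner_covφ (w u v : TangentSpace (𝓡 (2 * n + 1)) x) :
    S.g.inner x (S.covφ x w v) u = -S.g.inner x w (S.covφ x u v) := by
  obtain ⟨W, hW, rfl⟩ := exists_mdiffAt w
  obtain ⟨U, hU, rfl⟩ := exists_mdiffAt u
  have e : (fun y ↦ S.g.inner y (S.φField W y) (U y))
      = -fun y ↦ S.g.inner y (W y) (S.φField U y) := by
    ext y; exact S.inner_φ_left _ _
  have h1 := mvfderiv_inner S.g (S.mdiffAt_φField hW) hU v
  have h2 := mvfderiv_inner S.g hW (S.mdiffAt_φField hU) v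
  rw [e, mvfderiv_neg, neg_apply, h2, S.nabla_φField hW, S.nabla_φField hU] at h1
  simp only [φField, map_add, add_apply, S.inner_φ_left] at h1
  linarith

/-- Covariant derivative of φ² = -1 + η ⊗ ξ. -/
theorem covφ_φ (w v : TangentSpace (𝓡 (2 * n + 1)) x) :
    S.covφ x (S.φ x w) v + S.φ x (S.covφ x w v)
      = S.g.inner x (S.nablaξ x v) w • S.ξ x + S.η x w • S.nablaξ x v := by
  obtain ⟨W, hW, rfl⟩ := exists_mdiffAt w
  have hξ := S.smooth_ξ.mdiffAt x
  have hη := S.mdiffAt_ηFun hW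
  have h := S.nabla_φField (S.mdiffAt_φField hW) v
  rw [S.φField_φField, nabla_add S.g (by exact mdifferentiableAt_neg_section hW) (hη.smul_section hξ),
    nabla_neg S.g hW, nabla_smul S.g hη hξ, S.nabla_φField hW, map_add, S.φ_φ,
    S.mvfderiv_ηFun hW] at h
  change _ = S.covφ x (S.φ x (W x)) v + _ at h
  rw [← sub_eq_zero] at h ⊢
  rw [← neg_eq_zero, ← h]
  simp only [ηFun, nablaξ]
  module

/-- Covariant derivative of φξ = 0. -/
theorem covφ_ξ (v : TangentSpace (𝓡 (2 * n + 1)) x) :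
    S.covφ x (S.ξ x) v = -S.φ x (S.nablaξ x v) := by
  have h := S.nabla_φField (S.smooth_ξ.mdiffAt x) v
  have e : S.φField S.ξ = 0 := by
    ext y; exact S.φ_ξ y
  rw [e, nabla_zero] at h
  exact eq_neg_of_add_eq_zero_left h.symm

theorem φ_φ_nablaξ (v : TangentSpace (𝓡 (2 * n + 1)) x) :
    S.φ x (S.φ x (S.nablaξ x v)) = -S.nablaξ x v := by
  rw [S.φ_φ, S.η_nablaξ, zero_smul, add_zero]

theorem φ_φ_φ (v : TangentSpace (𝓡 (2 * n + 1)) x) :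
    S.φ x (S.φ x (S.φ x v)) = -S.φ x v := by
  rw [S.φ_φ, S.η_φ, zero_smul, add_zero]

theorem leviCivita_ξ (hX : MDiffField (𝓡 (2 * n + 1)) X x) :
    leviCivita S.g X S.ξ x = S.nablaξ x (X x) :=
  leviCivita_eq_nabla S.g hX (S.smooth_ξ.mdiffAt x)

theorem φField_ξ : S.φField S.ξ = 0 := by
  ext y; exact S.φ_ξ y

theorem leviCivita_zero_right (hX : IsSmoothField (𝓡 (2 * n + 1)) X) :
    leviCivita S.g X 0 = 0 := by
  ext y
  rw [leviCivita_eq_nabla S.g (hX.mdiffAt y) (isSmoothField_zero.mdiffAt y), nabla_zero]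
  rfl

theorem inner_ξ_left (v : TangentSpace (𝓡 (2 * n + 1)) x) :
    S.g.inner x (S.ξ x) v = S.η x v := (S.η_eq x v).symm

theorem inner_ξ_right (v : TangentSpace (𝓡 (2 * n + 1)) x) :
    S.g.inner x v (S.ξ x) = S.η x v := by
  rw [S.g.symm, S.η_eq]

/-- Serves the terms of the curvature identities in which φξ, the zero field, occupies the third
slot. -/
theorem curvature₄_zero (hX : IsSmoothField (𝓡 (2 * n + 1)) X)
    (hY : IsSmoothField (𝓡 (2 * n + 1)) Y) : curvature₄ S.g X Y 0 W x = 0 := by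
  rw [curvature₄, curvature, S.leviCivita_zero_right hX, S.leviCivita_zero_right hY,
    S.leviCivita_zero_right hX, S.leviCivita_zero_right (hX.mlieBracket hY)]
  simp

end Almost

end AlmostContactMetric

namespace AlmostContactMetric

/-! ### Contact metric structures -/

section ContactMetric

variable {n : ℕ} {M : Type*} [TopologicalSpace M]
  [ChartedSpace (EuclideanSpace ℝ (Fin (2 * n + 1))) M] [IsManifold (𝓡 (2 * n + 1)) ∞ M]
  [T2Space M] {S : AlmostContactMetric n M} {x : M}
  {X Y Z : ∀ x : M, TangentSpace (𝓡 (2 * n + 1)) x}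

/-- By torsion-freeness the left side is 2dη(v, w); the terms with derivatives of the extensions of
v and w cancel. Equivalently, B + φ is symmetric. -/
theorem inner_nablaξ_sub (hS : S.IsContactMetric) (v w : TangentSpace (𝓡 (2 * n + 1)) x) :
    S.g.inner x (S.nablaξ x v) w - S.g.inner x (S.nablaξ x w) v = 2 * S.g.inner x v (S.φ x w) := by
  obtain ⟨V, hV, rfl⟩ := exists_isSmoothField x v
  obtain ⟨W, hW, rfl⟩ := exists_isSmoothField x w
  have h := hS.2 V W hV hW x
  have h1 := S.mvfderiv_ηFun (hW.mdiffAt x) (V x)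
  have h2 := S.mvfderiv_ηFun (hV.mdiffAt x) (W x)
  rw [dForm, ← nabla_sub_nabla S.g (hV.mdiffAt x) (hW.mdiffAt x), map_sub] at h
  change (1 / 2 : ℝ) * (mvfderiv (𝓡 (2 * n + 1)) (S.ηFun W) x (V x)
    - mvfderiv (𝓡 (2 * n + 1)) (S.ηFun V) x (W x) - _) = S.g.inner x (V x) (S.φ x (W x)) at h
  rw [h1, h2] at h
  linarith

theorem nablaξ_ξ (hS : S.IsContactMetric) (x : M) : S.nablaξ x (S.ξ x) = 0 := by
  refine eq_of_inner_eq S.g fun w ↦ ?_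
  have h := inner_nablaξ_sub hS (S.ξ x) w
  rw [S.inner_nablaξ_ξ, ← S.η_eq, S.η_φ] at h
  simp only [map_zero, zero_apply]
  linarith

/-- `d(dη) = 0`. -/
theorem cyclic_inner_covφ (hS : S.IsContactMetric) (u v w : TangentSpace (𝓡 (2 * n + 1)) x) :
    S.g.inner x (S.covφ x v u) w + S.g.inner x (S.covφ x w v) u
      + S.g.inner x (S.covφ x u w) v = 0 := by
  obtain ⟨X, hX, rfl⟩ := exists_isSmoothField x u
  obtain ⟨Y, hY, rfl⟩ := exists_isSmoothField x v
  obtain ⟨Z, hZ, rfl⟩ := exists_isSmoothField x w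
  have hη {X : ∀ x : M, TangentSpace (𝓡 (2 * n + 1)) x} (hX : IsSmoothField (𝓡 (2 * n + 1)) X) :=
    S.contMDiff_ηFun hX
  have hd {f : M → ℝ} (hf : ContMDiff (𝓡 (2 * n + 1)) 𝓘(ℝ, ℝ) ∞ f) :
      MDifferentiableAt (𝓡 (2 * n + 1)) 𝓘(ℝ, ℝ) f x := hf.mdifferentiableAt (by simp)
  have e {X Y : ∀ x : M, TangentSpace (𝓡 (2 * n + 1)) x} (hX : IsSmoothField (𝓡 (2 * n + 1)) X)
      (hY : IsSmoothField (𝓡 (2 * n + 1)) Y) (y : M) :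
      mvfderiv (𝓡 (2 * n + 1)) (S.ηFun Y) y (X y) - mvfderiv (𝓡 (2 * n + 1)) (S.ηFun X) y (Y y)
        - S.ηFun (mlieBracket (𝓡 (2 * n + 1)) X Y) y
      = 2 * S.g.inner y (X y) (S.φField Y y) := by
    have := hS.2 X Y hX hY y
    rw [dForm] at this
    change (1 / 2 : ℝ) * (mvfderiv (𝓡 (2 * n + 1)) (S.ηFun Y) y (X y)
      - mvfderiv (𝓡 (2 * n + 1)) (S.ηFun X) y (Y y)
      - S.ηFun (mlieBracket (𝓡 (2 * n + 1)) X Y) y) = _ at this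
    linarith
  have step {U X Y : ∀ x : M, TangentSpace (𝓡 (2 * n + 1)) x}
      (hX : IsSmoothField (𝓡 (2 * n + 1)) X) (hY : IsSmoothField (𝓡 (2 * n + 1)) Y) :
      mvfderiv (𝓡 (2 * n + 1)) (fun y ↦ mvfderiv (𝓡 (2 * n + 1)) (S.ηFun Y) y (X y)) x (U x)
        - mvfderiv (𝓡 (2 * n + 1)) (fun y ↦ mvfderiv (𝓡 (2 * n + 1)) (S.ηFun X) y (Y y)) x (U x)
        - mvfderiv (𝓡 (2 * n + 1)) (S.ηFun (mlieBracket (𝓡 (2 * n + 1)) X Y)) x (U x)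
      = 2 * (S.g.inner x (nabla S.g X x (U x)) (S.φ x (Y x))
        + S.g.inner x (X x) (S.covφ x (Y x) (U x) + S.φ x (nabla S.g Y x (U x)))) := by
    have h := congrArg (fun f ↦ mvfderiv (𝓡 (2 * n + 1)) f x (U x)) (funext (e hX hY))
    have hXY := hX.mvfderiv (hη hY)
    have hYX := hY.mvfderiv (hη hX)
    have h1 : MDifferentiableAt (𝓡 (2 * n + 1)) 𝓘(ℝ, ℝ)
        (fun y ↦ S.g.inner y (X y) (S.φField Y y)) x :=
      hd (hX.inner S.g (S.isSmoothField_φField hY))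
    rw [← S.nabla_φField (hY.mdiffAt x)]
    change _ = 2 * (S.g.inner x (nabla S.g X x (U x)) (S.φField Y x) + _)
    rw [← mvfderiv_inner S.g (hX.mdiffAt x) (S.mdiffAt_φField (hY.mdiffAt x))]
    have e1 : mvfderiv (𝓡 (2 * n + 1)) (fun y ↦ 2 * S.g.inner y (X y) (S.φField Y y)) x
        = (2 : ℝ) • mvfderiv (𝓡 (2 * n + 1)) (fun y ↦ S.g.inner y (X y) (S.φField Y y)) x := by
      rw [mvfderiv_fun_mul mdifferentiableAt_const h1, mvfderiv_const, smul_zero, add_zero]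
    simp only [e1] at h
    have e2 := mvfderiv_sub ((hd hXY).sub (hd hYX)) (hd (hη (hX.mlieBracket hY)))
    rw [mvfderiv_sub (hd hXY) (hd hYX)] at e2
    exact (congrArg (fun L ↦ L (U x)) e2).symm.trans h
  -- In the sum of the three differentiated contact identities the second derivatives pair into [X,
  -- Y]η(Z) and its cyclic images. The contact identity for bracket fields removes these, Jacobi
  -- kills η of the double brackets, and expanding [X, Y] = ∇_X Y - ∇_Y X leaves only the terms in
  -- ∇φ.
  have s1 := step (U := X) hY hZ
  have s2 := step (U := Y) hZ hX
  have s3 := step (U := Z) hX hY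
  have d1 := mvfderiv_mlieBracket hX hY (hη hZ) x
  have d2 := mvfderiv_mlieBracket hY hZ (hη hX) x
  have d3 := mvfderiv_mlieBracket hZ hX (hη hY) x
  have b1 := e (hX.mlieBracket hY) hZ x
  have b2 := e (hY.mlieBracket hZ) hX x
  have b3 := e (hZ.mlieBracket hX) hY x
  have jac : S.ηFun (mlieBracket (𝓡 (2 * n + 1)) (mlieBracket (𝓡 (2 * n + 1)) X Y) Z) x
      + S.ηFun (mlieBracket (𝓡 (2 * n + 1)) (mlieBracket (𝓡 (2 * n + 1)) Y Z) X) x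
      + S.ηFun (mlieBracket (𝓡 (2 * n + 1)) (mlieBracket (𝓡 (2 * n + 1)) Z X) Y) x = 0 := by
    have j := mlieBracket_jacobi hX hY hZ x
    have i1 : mlieBracket (𝓡 (2 * n + 1)) (mlieBracket (𝓡 (2 * n + 1)) Y Z) X x
        = -mlieBracket (𝓡 (2 * n + 1)) X (mlieBracket (𝓡 (2 * n + 1)) Y Z) x :=
      mlieBracket_swap_apply
    have i2 : mlieBracket (𝓡 (2 * n + 1)) (mlieBracket (𝓡 (2 * n + 1)) Z X) Y x
        = mlieBracket (𝓡 (2 * n + 1)) Y (mlieBracket (𝓡 (2 * n + 1)) X Z) x := by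
      rw [mlieBracket_swap (V := Z) (W := X), mlieBracket_swap_apply, ← neg_one_smul ℝ,
        ← neg_one_smul ℝ (mlieBracket (𝓡 (2 * n + 1)) X Z),
        mlieBracket_const_smul_right ((hX.mlieBracket hZ).mdiffAt x)]
      simp
    simp only [ηFun]
    rw [i1, i2, j, ← map_add, ← map_add]
    convert! map_zero (S.η x) using 2
    abel
  rw [← nabla_sub_nabla S.g (hX.mdiffAt x) (hY.mdiffAt x)] at b1 d1
  rw [← nabla_sub_nabla S.g (hY.mdiffAt x) (hZ.mdiffAt x)] at b2 d2
  rw [← nabla_sub_nabla S.g (hZ.mdiffAt x) (hX.mdiffAt x)] at b3 d3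
  simp only [φField, map_sub, map_add, sub_apply] at b1 b2 b3 s1 s2 s3 d1 d2 d3
  have k1 := S.inner_φ_left (Y x) (nabla S.g Z x (X x))
  have k2 := S.inner_φ_left (Z x) (nabla S.g X x (Y x))
  have k3 := S.inner_φ_left (X x) (nabla S.g Y x (Z x))
  have t1 := S.g.symm x (S.φ x (Y x)) (nabla S.g Z x (X x))
  have t2 := S.g.symm x (S.φ x (Z x)) (nabla S.g X x (Y x))
  have t3 := S.g.symm x (S.φ x (X x)) (nabla S.g Y x (Z x))
  have c1 := S.inner_covφ (Y x) (Z x) (X x)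
  have c2 := S.inner_covφ (Z x) (X x) (Y x)
  have c3 := S.inner_covφ (X x) (Y x) (Z x)
  linarith

end ContactMetric

end AlmostContactMetric

namespace AlmostContactMetric

/-! ### The operator ∇ξ and the curvature R(ξ, ·)ξ of a contact metric structure -/

section ContactMetricConsequences

variable {n : ℕ} {M : Type*} [TopologicalSpace M]
  [ChartedSpace (EuclideanSpace ℝ (Fin (2 * n + 1))) M] [IsManifold (𝓡 (2 * n + 1)) ∞ M]
  [T2Space M] {S : AlmostContactMetric n M} {x : M}
  {X Y Z W : ∀ x : M, TangentSpace (𝓡 (2 * n + 1)) x}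

/-- The cyclic identity with one entry ξ: the other two terms involve (∇φ)ξ = -φB, and the skew part
of B is known. -/
theorem covφ_apply_ξ_eq (hS : S.IsContactMetric) (v : TangentSpace (𝓡 (2 * n + 1)) x) :
    S.covφ x v (S.ξ x)
      = -S.φ x (S.nablaξ x v) - S.nablaξ x (S.φ x v) - (2 : ℝ) • S.φ x (S.φ x v) := by
  refine eq_of_inner_eq S.g fun w ↦ ?_
  have h1 := cyclic_inner_covφ hS (S.ξ x) v w
  rw [S.covφ_ξ, S.inner_covφ w, S.covφ_ξ] at h1
  have h2 := inner_nablaξ_sub hS (S.φ x v) w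
  have h3 := S.inner_φ_left (S.nablaξ x w) v
  have h4 := S.inner_φ_left (S.φ x v) w
  have h5 := S.g.symm x w (S.φ x (S.nablaξ x v))
  simp only [map_sub, map_neg, map_smul, sub_apply, neg_apply, smul_apply, smul_eq_mul] at h1 ⊢
  linarith

/-- `∇_ξ φ = 0`. -/
theorem covφ_apply_ξ (hS : S.IsContactMetric) (v : TangentSpace (𝓡 (2 * n + 1)) x) :
    S.covφ x v (S.ξ x) = 0 := by
  -- Differentiating φ² along ξ gives (∇_ξ φ)φ + φ(∇_ξ φ) = 0, since Bξ = 0. Inserting the formula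
  -- for ∇_ξ φ yields φBφ = B + 2φ, and one more φ makes that formula vanish.
  have h := S.covφ_φ v (S.ξ x)
  rw [nablaξ_ξ hS, covφ_apply_ξ_eq hS, covφ_apply_ξ_eq hS] at h
  simp only [map_zero, zero_apply, zero_smul, smul_zero, add_zero, map_sub, map_neg, map_smul,
    S.φ_φ_φ, S.φ_φ_nablaξ] at h
  rw [S.φ_φ x v, map_add, map_smul, nablaξ_ξ hS, map_neg, smul_zero, add_zero] at h
  have h' : S.φ x (S.nablaξ x (S.φ x v)) = S.nablaξ x v + (2 : ℝ) • S.φ x v := by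
    have : (2 : ℝ) • S.φ x (S.nablaξ x (S.φ x v))
        = (2 : ℝ) • (S.nablaξ x v + (2 : ℝ) • S.φ x v) := by
      rw [← sub_eq_zero, ← neg_eq_zero, ← h]
      module
    exact smul_right_injective _ two_ne_zero this
  have h'' := congrArg (S.φ x) h'
  rw [S.φ_φ_nablaξ, map_add, map_smul] at h''
  rw [covφ_apply_ξ_eq hS, sub_eq_add_neg _ (S.nablaξ x _), h'']
  module

/-- This is ∇_ξ φ = 0 read through `covφ_apply_ξ_eq`, that is, Bφ + φB = -2φ². -/
theorem nablaξ_φ (hS : S.IsContactMetric) (v : TangentSpace (𝓡 (2 * n + 1)) x) :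
    S.nablaξ x (S.φ x v) = -S.φ x (S.nablaξ x v) + (2 : ℝ) • v - (2 * S.η x v) • S.ξ x := by
  have h := covφ_apply_ξ hS v
  rw [covφ_apply_ξ_eq hS, S.φ_φ] at h
  rw [← sub_eq_zero, ← neg_eq_zero, ← h]
  module

theorem nabla_φField_ξ (hS : S.IsContactMetric) (hX : MDiffField (𝓡 (2 * n + 1)) X x) :
    nabla S.g (S.φField X) x (S.ξ x) = S.φ x (nabla S.g X x (S.ξ x)) := by
  rw [S.nabla_φField hX, covφ_apply_ξ hS, zero_add]

variable (S) in
/-- The vector field `∇_X ξ`. -/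
def nablaξField (X : ∀ x : M, TangentSpace (𝓡 (2 * n + 1)) x) (x : M) :
    TangentSpace (𝓡 (2 * n + 1)) x :=
  S.nablaξ x (X x)

/-- As ∇_ξ φ = 0, the bracket expression [ξ, φX] - φ[ξ, X] equals φBX - BφX = 2(φBX - X + η(X)ξ).
Solving for BX, using φ²B = -B, writes it through brackets and φ, whose smoothness is known. -/
theorem isSmoothField_nablaξField (hS : S.IsContactMetric)
    (hX : IsSmoothField (𝓡 (2 * n + 1)) X) :
    IsSmoothField (𝓡 (2 * n + 1)) (S.nablaξField X) := by
  have hφX := S.isSmoothField_φField hX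
  have e : S.nablaξField X = -S.φField (((fun _ : M ↦ (1 / 2 : ℝ)) • (mlieBracket (𝓡 (2 * n + 1)) S.ξ (S.φField X)
      - S.φField (mlieBracket (𝓡 (2 * n + 1)) S.ξ X))) + X - S.ηFun X • S.ξ) := by
    ext y
    simp only [Pi.neg_apply, φField, Pi.add_apply, Pi.sub_apply, Pi.smul_apply', nablaξField, ηFun]
    rw [← nabla_sub_nabla S.g (S.smooth_ξ.mdiffAt y) (hφX.mdiffAt y),
      ← nabla_sub_nabla S.g (S.smooth_ξ.mdiffAt y) (hX.mdiffAt y),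
      nabla_φField_ξ hS (hX.mdiffAt y)]
    change _ = -S.φ y ((1 / 2 : ℝ) • (_ - S.nablaξ y (S.φ y (X y)) - S.φ y (_ - S.nablaξ y (X y)))
      + _ - _)
    rw [nablaξ_φ hS]
    simp only [map_add, map_sub, map_smul, map_neg, S.φ_φ_nablaξ, S.φ_ξ]
    module
  rw [e]
  exact (S.isSmoothField_φField (((((S.smooth_ξ.mlieBracket hφX).sub (S.isSmoothField_φField (S.smooth_ξ.mlieBracket hX))).smul contMDiff_const).add hX).sub
    (S.smooth_ξ.smul (S.contMDiff_ηFun hX)))).neg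

theorem curvature_ξ (hS : S.IsContactMetric) (hX : IsSmoothField (𝓡 (2 * n + 1)) X)
    (hY : IsSmoothField (𝓡 (2 * n + 1)) Y) :
    curvature S.g X Y S.ξ x = nabla S.g (S.nablaξField Y) x (X x)
      - nabla S.g (S.nablaξField X) x (Y x)
      - S.nablaξ x (nabla S.g Y x (X x) - nabla S.g X x (Y x)) := by
  have e {X : ∀ x : M, TangentSpace (𝓡 (2 * n + 1)) x} (hX : IsSmoothField (𝓡 (2 * n + 1)) X) :
      leviCivita S.g X S.ξ = S.nablaξField X := by
    ext y; exact S.leviCivita_ξ (hX.mdiffAt y)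
  rw [curvature, e hX, e hY, S.leviCivita_ξ ((hX.mlieBracket hY).mdiffAt x),
    leviCivita_eq_nabla S.g (hX.mdiffAt x) ((isSmoothField_nablaξField hS hY).mdiffAt x),
    leviCivita_eq_nabla S.g (hY.mdiffAt x) ((isSmoothField_nablaξField hS hX).mdiffAt x),
    nabla_sub_nabla S.g (hX.mdiffAt x) (hY.mdiffAt x)]

/-- As Bξ = 0, the right side is (∇_ξ B)X + B²X. -/
theorem curvature_ξ_ξ (hS : S.IsContactMetric) (hX : IsSmoothField (𝓡 (2 * n + 1)) X) :
    curvature S.g S.ξ X S.ξ x = nabla S.g (S.nablaξField X) x (S.ξ x)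
      - S.nablaξ x (nabla S.g X x (S.ξ x)) + S.nablaξ x (S.nablaξ x (X x)) := by
  have e : S.nablaξField S.ξ = 0 := by
    ext y; exact nablaξ_ξ hS y
  rw [curvature_ξ hS S.smooth_ξ hX, e, nabla_zero, map_sub]
  simp only [nablaξ]
  abel

/-- Differentiating Bφ + φB = -2φ² along ξ, where φ, ξ and η are parallel, shows that ∇_ξ B
anticommutes with φ. Only B²φ + φB² survives, and B² commutes with φ. -/
theorem curvature_ξ_φField_ξ (hS : S.IsContactMetric) (hX : IsSmoothField (𝓡 (2 * n + 1)) X) :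
    curvature S.g S.ξ (S.φField X) S.ξ x + S.φ x (curvature S.g S.ξ X S.ξ x)
      = (2 : ℝ) • S.φ x (S.nablaξ x (S.nablaξ x (X x))) := by
  have hB := isSmoothField_nablaξField hS hX
  have hφB := S.isSmoothField_φField hB
  have hηX := S.contMDiff_ηFun hX
  have hηξ := S.smooth_ξ.smul hηX
  have e : S.nablaξField (S.φField X)
      = -S.φField (S.nablaξField X) + ((2 : ℝ) • X + (-2 : ℝ) • (S.ηFun X • S.ξ)) := by
    ext y
    change S.nablaξ y (S.φ y (X y)) = -S.φ y (S.nablaξ y (X y))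
      + ((2 : ℝ) • X y + (-2 : ℝ) • (S.η y (X y) • S.ξ y))
    rw [nablaξ_φ hS]
    module
  have hc {X : ∀ x : M, TangentSpace (𝓡 (2 * n + 1)) x} (c : ℝ)
      (hX : IsSmoothField (𝓡 (2 * n + 1)) X) : IsSmoothField (𝓡 (2 * n + 1)) (c • X) :=
    hX.smul (f := fun _ ↦ c) contMDiff_const
  have h0 : nabla S.g S.ξ x (S.ξ x) = 0 := nablaξ_ξ hS x
  rw [curvature_ξ_ξ hS hX, curvature_ξ_ξ hS (S.isSmoothField_φField hX), e,
    nabla_add S.g (hφB.neg.mdiffAt x) (((hc 2 hX).add (hc (-2) hηξ)).mdiffAt x),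
    nabla_neg S.g (hφB.mdiffAt x), nabla_add S.g ((hc 2 hX).mdiffAt x) ((hc (-2) hηξ).mdiffAt x),
    nabla_const_smul S.g _ (hX.mdiffAt x), nabla_const_smul S.g _ (hηξ.mdiffAt x),
    nabla_smul S.g (hηX.mdifferentiableAt (by simp)) (S.smooth_ξ.mdiffAt x), h0,
    S.mvfderiv_ηFun (hX.mdiffAt x), nablaξ_ξ hS, nabla_φField_ξ hS (hB.mdiffAt x),
    nabla_φField_ξ hS (hX.mdiffAt x), nablaξ_φ hS]
  change _ + S.nablaξ x (S.nablaξ x (S.φ x (X x))) + _ = _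
  rw [nablaξ_φ hS]
  simp only [map_add, map_sub, map_smul, map_neg, nablaξ_ξ hS, nablaξ_φ hS, S.η_nablaξ, zero_apply,
    map_zero]
  module

/-- If `R(ξ, Y)ξ = η(Y)ξ - Y` on a contact metric manifold, then `∇ξ = -φ`. -/
theorem nablaξ_eq (hS : S.IsContactMetric)
    (hR : ∀ Y : ∀ x : M, TangentSpace (𝓡 (2 * n + 1)) x, IsSmoothField (𝓡 (2 * n + 1)) Y →
      ∀ x, curvature S.g S.ξ Y S.ξ x = S.η x (Y x) • S.ξ x - Y x)
    (v : TangentSpace (𝓡 (2 * n + 1)) x) : S.nablaξ x v = -S.φ x v := by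
  -- B² = φ²: the curvature hypothesis gives φB² = -φ, and applying φ removes the factor because the
  -- image of B lies in ker η.
  have hBB (v : TangentSpace (𝓡 (2 * n + 1)) x) :
      S.nablaξ x (S.nablaξ x v) = S.η x v • S.ξ x - v := by
    obtain ⟨V, hV, rfl⟩ := exists_isSmoothField x v
    have h := curvature_ξ_φField_ξ (x := x) hS hV
    rw [hR _ hV, hR _ (S.isSmoothField_φField hV)] at h
    have h1 : S.φ x (S.nablaξ x (S.nablaξ x (V x))) = -S.φ x (V x) := by
      refine smul_right_injective _ (two_ne_zero (α := ℝ)) ?_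
      change (2 : ℝ) • _ = (2 : ℝ) • _
      rw [← h]
      simp only [φField, S.η_φ, map_sub, map_smul, S.φ_ξ]
      module
    have h2 := congrArg (S.φ x) h1
    rw [S.φ_φ_nablaξ, map_neg, S.φ_φ] at h2
    rw [← neg_inj, h2]
    module
  -- (B + φ)² = B² + φ² + (Bφ + φB) = 2φ² - 2φ² = 0. By symmetry the norm of (B + φ)v is then zero.
  have hSS : S.nablaξ x (S.nablaξ x v + S.φ x v) + S.φ x (S.nablaξ x v + S.φ x v) = 0 := by
    rw [map_add, map_add, hBB, nablaξ_φ hS, S.φ_φ]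
    module
  have hsym (u w : TangentSpace (𝓡 (2 * n + 1)) x) :
      S.g.inner x (S.nablaξ x u + S.φ x u) w = S.g.inner x u (S.nablaξ x w + S.φ x w) := by
    have h1 := inner_nablaξ_sub hS u w
    have h2 := S.inner_φ_left u w
    have h3 := S.g.symm x u (S.nablaξ x w)
    simp only [map_add, add_apply]
    linarith
  refine eq_neg_of_add_eq_zero_left (eq_zero_of_inner_self S.g ?_)
  rw [hsym, hSS, map_zero]

end ContactMetricConsequences

end AlmostContactMetric

namespace AlmostContactMetric

/-! ### Consequences of the curvature identities -/

section CurvatureIdentities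

variable {n : ℕ} {M : Type*} [TopologicalSpace M]
  [ChartedSpace (EuclideanSpace ℝ (Fin (2 * n + 1))) M] [IsManifold (𝓡 (2 * n + 1)) ∞ M]
  {S : AlmostContactMetric n M} {x : M}
  {X Y Z W : ∀ x : M, TangentSpace (𝓡 (2 * n + 1)) x}

/-- For Z = ξ the second curvature term dies with φξ, and the Φ-terms die because Φ(·, ξ) = η ∘ φ =
0. -/
theorem SatisfiesG₁.curvature₄_ξ (h : S.SatisfiesG₁) (hX : IsSmoothField (𝓡 (2 * n + 1)) X)
    (hY : IsSmoothField (𝓡 (2 * n + 1)) Y) (hW : IsSmoothField (𝓡 (2 * n + 1)) W) (x : M) :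
    curvature₄ S.g X Y S.ξ W x
      = S.g.inner x (X x) (W x) * S.η x (Y x) - S.g.inner x (Y x) (W x) * S.η x (X x) := by
  have := h X Y S.ξ W hX hY S.smooth_ξ hW x
  rw [S.φField_ξ, S.curvature₄_zero hX hY] at this
  simp only [gFun, ΦFun, φField, S.inner_ξ_right, S.η_φ] at this
  linarith

theorem SatisfiesG₃.curvature₄_ξ (h : S.SatisfiesG₃) (hX : IsSmoothField (𝓡 (2 * n + 1)) X)
    (hY : IsSmoothField (𝓡 (2 * n + 1)) Y) (hW : IsSmoothField (𝓡 (2 * n + 1)) W) (x : M) :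
    curvature₄ S.g X Y S.ξ W x
      = S.g.inner x (X x) (W x) * S.η x (Y x) - S.g.inner x (Y x) (W x) * S.η x (X x) := by
  have := h X Y S.ξ W hX hY S.smooth_ξ hW x
  rw [S.φField_ξ, S.curvature₄_zero (S.isSmoothField_φField hX) (S.isSmoothField_φField hY)] at this
  simp only [gFun, ηFun, S.inner_ξ_right, S.η_ξ] at this
  linarith

/-- Setting Z = ξ removes just one of the three φ-terms, so R(X, Y)ξ is not yet determined. -/
theorem SatisfiesG₂.curvature₄_ξ (h : S.SatisfiesG₂) (hX : IsSmoothField (𝓡 (2 * n + 1)) X)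
    (hY : IsSmoothField (𝓡 (2 * n + 1)) Y) (hW : IsSmoothField (𝓡 (2 * n + 1)) W) (x : M) :
    curvature₄ S.g X Y S.ξ W x - curvature₄ S.g (S.φField X) (S.φField Y) S.ξ W x
        - curvature₄ S.g (S.φField X) Y S.ξ (S.φField W) x
      = S.η x (Y x) * S.η x (X x) * S.η x (W x) - S.g.inner x (Y x) (W x) * S.η x (X x) := by
  have := h X Y S.ξ W hX hY S.smooth_ξ hW x
  rw [S.φField_ξ, S.curvature₄_zero (S.isSmoothField_φField hX) hY] at this
  simp only [gFun, ηFun, S.inner_ξ_right, S.η_ξ] at this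
  linarith

variable [T2Space M]

/-- Used when X = ξ in (G₂), where φX is the zero field. -/
theorem curvature₄_zero_left (hS : S.IsContactMetric) (hY : IsSmoothField (𝓡 (2 * n + 1)) Y) :
    curvature₄ S.g 0 Y S.ξ W x = 0 := by
  have e : S.nablaξField 0 = 0 := by
    ext y; exact map_zero (S.nablaξ y)
  rw [curvature₄, curvature_ξ hS isSmoothField_zero hY, e, nabla_zero]
  simp

theorem curvature_ξ_of_inner
    (h : ∀ Y W : ∀ x : M, TangentSpace (𝓡 (2 * n + 1)) x, IsSmoothField (𝓡 (2 * n + 1)) Y →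
      IsSmoothField (𝓡 (2 * n + 1)) W → ∀ x, curvature₄ S.g S.ξ Y S.ξ W x
        = S.η x (Y x) * S.η x (W x) - S.g.inner x (Y x) (W x))
    (hY : IsSmoothField (𝓡 (2 * n + 1)) Y) (x : M) :
    curvature S.g S.ξ Y S.ξ x = S.η x (Y x) • S.ξ x - Y x := by
  refine eq_of_inner_eq S.g fun w ↦ ?_
  obtain ⟨W, hW, rfl⟩ := exists_isSmoothField x w
  have := h Y W hY hW x
  rw [curvature₄] at this
  rw [this]
  simp [S.inner_ξ_left]

/-- On a K-contact manifold, `R(X, Y, ξ, W) = g((∇_W φ)X, Y)`. -/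
theorem curvature₄_ξ_eq (hS : S.IsContactMetric)
    (hB : ∀ (x : M) (v : TangentSpace (𝓡 (2 * n + 1)) x), S.nablaξ x v = -S.φ x v)
    (hX : IsSmoothField (𝓡 (2 * n + 1)) X) (hY : IsSmoothField (𝓡 (2 * n + 1)) Y) :
    curvature₄ S.g X Y S.ξ W x = S.g.inner x (S.covφ x (X x) (W x)) (Y x) := by
  have e (X : ∀ x : M, TangentSpace (𝓡 (2 * n + 1)) x) : S.nablaξField X = -S.φField X := by
    ext y; exact hB y _
  -- With B = -φ, R(X, Y)ξ = (∇_Y φ)X - (∇_X φ)Y; skewness and the cyclic identity merge the two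
  -- terms into one.
  have h1 := cyclic_inner_covφ hS (X x) (Y x) (W x)
  have h2 := S.inner_covφ (X x) (W x) (Y x)
  have h3 := S.g.symm x (X x) (S.covφ x (W x) (Y x))
  rw [curvature₄, curvature_ξ hS hX hY, e, e,
    nabla_neg S.g (S.mdiffAt_φField (hX.mdiffAt x)), nabla_neg S.g (S.mdiffAt_φField (hY.mdiffAt x)),
    S.nabla_φField (hX.mdiffAt x), S.nabla_φField (hY.mdiffAt x), hB]
  simp only [map_add, map_sub, map_neg, add_apply, sub_apply, neg_apply]
  linarith

/-- On a contact metric manifold, each of the identities `(G₁)`, `(G₂)`, `(G₃)` implies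
`∇ξ = -φ`. -/
theorem nablaξ_eq_of_curvature (hS : S.IsContactMetric)
    (hG : S.SatisfiesG₁ ∨ S.SatisfiesG₂ ∨ S.SatisfiesG₃)
    (x : M) (v : TangentSpace (𝓡 (2 * n + 1)) x) : S.nablaξ x v = -S.φ x v := by
  refine nablaξ_eq hS (fun Y hY ↦ curvature_ξ_of_inner (fun Y W hY hW x ↦ ?_) hY) v
  rcases hG with h | h | h
  · rw [h.curvature₄_ξ S.smooth_ξ hY hW, S.inner_ξ_left, S.η_ξ]
    ring
  · have := h.curvature₄_ξ S.smooth_ξ hY hW x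
    rw [S.φField_ξ, curvature₄_zero_left hS (S.isSmoothField_φField hY),
      curvature₄_zero_left hS hY, S.η_ξ] at this
    linarith
  · rw [h.curvature₄_ξ S.smooth_ξ hY hW, S.inner_ξ_left, S.η_ξ]
    ring

theorem covφ_eq_of_curvature₄_ξ (hS : S.IsContactMetric)
    (hB : ∀ (x : M) (v : TangentSpace (𝓡 (2 * n + 1)) x), S.nablaξ x v = -S.φ x v)
    (h : ∀ X Y W : ∀ x : M, TangentSpace (𝓡 (2 * n + 1)) x, IsSmoothField (𝓡 (2 * n + 1)) X →
      IsSmoothField (𝓡 (2 * n + 1)) Y → IsSmoothField (𝓡 (2 * n + 1)) W → ∀ x,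
      curvature₄ S.g X Y S.ξ W x
        = S.g.inner x (X x) (W x) * S.η x (Y x) - S.g.inner x (Y x) (W x) * S.η x (X x))
    (w v : TangentSpace (𝓡 (2 * n + 1)) x) :
    S.covφ x w v = S.g.inner x w v • S.ξ x - S.η x w • v := by
  refine eq_of_inner_eq S.g fun u ↦ ?_
  obtain ⟨X, hX, rfl⟩ := exists_isSmoothField x w
  obtain ⟨W, hW, rfl⟩ := exists_isSmoothField x v
  obtain ⟨Y, hY, rfl⟩ := exists_isSmoothField x u
  rw [← curvature₄_ξ_eq hS hB hX hY, h X Y W hX hY hW]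
  simp [S.inner_ξ_left, S.g.symm x (Y x) (W x), mul_comm]

/-- The case Z = ξ of (G₂), with each curvature term replaced by its value in terms of ∇φ. -/
theorem SatisfiesG₂.covφ_add (hS : S.IsContactMetric)
    (hB : ∀ (x : M) (v : TangentSpace (𝓡 (2 * n + 1)) x), S.nablaξ x v = -S.φ x v)
    (h : S.SatisfiesG₂) (w v : TangentSpace (𝓡 (2 * n + 1)) x) :
      S.covφ x w v + S.φ x (S.covφ x (S.φ x w) v) - S.covφ x (S.φ x w) (S.φ x v)
        = S.η x w • (S.η x v • S.ξ x - v) := by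
  refine eq_of_inner_eq S.g fun u ↦ ?_
  obtain ⟨X, hX, rfl⟩ := exists_isSmoothField x w
  obtain ⟨W, hW, rfl⟩ := exists_isSmoothField x v
  obtain ⟨Y, hY, rfl⟩ := exists_isSmoothField x u
  have h1 := h.curvature₄_ξ hX hY hW x
  rw [curvature₄_ξ_eq hS hB hX hY,
    curvature₄_ξ_eq hS hB (S.isSmoothField_φField hX) (S.isSmoothField_φField hY),
    curvature₄_ξ_eq hS hB (S.isSmoothField_φField hX) hY] at h1
  simp only [φField] at h1
  have h2 := S.inner_φ_left (S.covφ x (S.φ x (X x)) (W x)) (Y x)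
  simp only [map_add, map_sub, map_smul, add_apply, sub_apply, smul_apply, smul_eq_mul,
    S.inner_ξ_left, S.g.symm x (W x) (Y x)]
  linarith

/-- The defect D of the claimed formula anticommutes with φ in its first entry, vanishes when either
entry is ξ, and is scaled by 2 when φ is applied to both entries. Since φ² acts as -1 modulo ξ, this
forces D = 0. -/
theorem SatisfiesG₂.covφ_eq (hS : S.IsContactMetric)
    (hB : ∀ (x : M) (v : TangentSpace (𝓡 (2 * n + 1)) x), S.nablaξ x v = -S.φ x v)
    (h : S.SatisfiesG₂) (w v : TangentSpace (𝓡 (2 * n + 1)) x) :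
    S.covφ x w v = S.g.inner x w v • S.ξ x - S.η x w • v := by
  have hG := fun w v ↦ h.covφ_add (x := x) hS hB w v
  let D (w v : TangentSpace (𝓡 (2 * n + 1)) x) : TangentSpace (𝓡 (2 * n + 1)) x :=
    S.covφ x w v - (S.g.inner x w v • S.ξ x - S.η x w • v)
  -- The model tensor g(w, v)ξ - η(w)v satisfies the same differentiated φ²-identity as ∇φ, so the
  -- inhomogeneous terms cancel in D.
  have hDφ (w v : TangentSpace (𝓡 (2 * n + 1)) x) : D (S.φ x w) v = -S.φ x (D w v) := by
    have h1 := S.covφ_φ w v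
    have h2 := S.inner_φ_left v w
    have h3 := S.g.symm x v (S.φ x w)
    rw [hB] at h1
    simp only [D, map_sub, map_smul, S.η_φ, S.φ_ξ]
    rw [eq_sub_of_add_eq h1, map_neg, neg_apply, h2, h3]
    module
  have hDξ_left (v : TangentSpace (𝓡 (2 * n + 1)) x) : D (S.ξ x) v = 0 := by
    simp only [D]
    rw [S.covφ_ξ, hB, map_neg, S.φ_φ, S.inner_ξ_left, S.η_ξ]
    module
  have hDξ_right (w : TangentSpace (𝓡 (2 * n + 1)) x) : D w (S.ξ x) = 0 := by
    simp only [D]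
    rw [covφ_apply_ξ hS, S.inner_ξ_right]
    module
  have hφφ_left (w v : TangentSpace (𝓡 (2 * n + 1)) x) : D (S.φ x (S.φ x w)) v = -D w v := by
    have : D (S.φ x (S.φ x w)) v = -D w v + S.η x w • D (S.ξ x) v := by
      simp only [D, S.φ_φ, map_add, map_neg, map_smul, add_apply, neg_apply, smul_apply, smul_eq_mul]
      module
    rw [this, hDξ_left, smul_zero, add_zero]
  have hφφ_right (w v : TangentSpace (𝓡 (2 * n + 1)) x) : D w (S.φ x (S.φ x v)) = -D w v := by
    have : D w (S.φ x (S.φ x v)) = -D w v + S.η x v • D w (S.ξ x) := by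
      simp only [D, S.φ_φ, map_add, map_neg, map_smul, smul_eq_mul]
      module
    rw [this, hDξ_right, smul_zero, add_zero]
  have h2D (w v : TangentSpace (𝓡 (2 * n + 1)) x) : D (S.φ x w) (S.φ x v) = (2 : ℝ) • D w v := by
    have h1 : D w v + S.φ x (D (S.φ x w) v) - D (S.φ x w) (S.φ x v) = 0 := by
      have h2 := hG w v
      simp only [D, map_sub, map_smul, S.η_φ, S.φ_ξ, S.g_φ_φ, smul_zero, zero_smul, sub_zero]
      rw [← sub_eq_zero] at h2
      rw [← h2]
      module
    have h3 : S.φ x (D (S.φ x w) v) = D w v := by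
      have := hDφ (S.φ x w) v
      rw [hφφ_left] at this
      exact (neg_injective this).symm
    rw [h3, sub_eq_zero] at h1
    rw [← h1, two_smul]
  -- D(φ²w, φ²v) is D(w, v) by the two sign changes, and 2·2·D(w, v) by doubling twice.
  have h4 : D w v = (4 : ℝ) • D w v := by
    have h5 := h2D (S.φ x w) (S.φ x v)
    rw [hφφ_left, hφφ_right, neg_neg, h2D, smul_smul] at h5
    rwa [show (2 : ℝ) * 2 = 4 by norm_num] at h5
  have h5 : (3 : ℝ) • D w v = 0 := by
    rw [← sub_eq_zero] at h4
    rw [← neg_eq_zero, ← h4]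
    module
  exact sub_eq_zero.1 ((smul_eq_zero.1 h5).resolve_left (by norm_num))

/-- A contact metric structure satisfying one of the identities `(G₁)`, `(G₂)`, `(G₃)` has
`(∇_v φ)w = g(w, v)ξ - η(w)v`. -/
theorem covφ_eq_of_curvature (hS : S.IsContactMetric)
    (hG : S.SatisfiesG₁ ∨ S.SatisfiesG₂ ∨ S.SatisfiesG₃)
    (w v : TangentSpace (𝓡 (2 * n + 1)) x) :
    S.covφ x w v = S.g.inner x w v • S.ξ x - S.η x w • v := by
  have hB := nablaξ_eq_of_curvature hS hG
  rcases hG with h | h | h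
  · exact covφ_eq_of_curvature₄_ξ hS hB (fun _ _ _ hX hY hW ↦ h.curvature₄_ξ hX hY hW) w v
  · exact h.covφ_eq hS hB w v
  · exact covφ_eq_of_curvature₄_ξ hS hB (fun _ _ _ hX hY hW ↦ h.curvature₄_ξ hX hY hW) w v

end CurvatureIdentities

end AlmostContactMetric

/-! ### The Nijenhuis torsion is a tensor -/

section Nijenhuis

variable {E : Type*} [NormedAddCommGroup E] [NormedSpace ℝ E]
  {H : Type*} [TopologicalSpace H] {I : ModelWithCorners ℝ E H}
  {M : Type*} [TopologicalSpace M] [ChartedSpace H M]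
  {J : ∀ x : M, TangentSpace I x →L[ℝ] TangentSpace I x} {x : M}
  {X Y : ∀ x : M, TangentSpace I x}

theorem nijenhuis_swap : nijenhuis I J X Y x = -nijenhuis I J Y X x := by
  simp only [nijenhuis]
  rw [mlieBracket_swap_apply (V := X) (W := Y),
    mlieBracket_swap_apply (V := fun y ↦ J y (X y)) (W := fun y ↦ J y (Y y)),
    mlieBracket_swap_apply (V := fun y ↦ J y (X y)) (W := Y),
    mlieBracket_swap_apply (V := X) (W := fun y ↦ J y (Y y))]
  simp only [map_neg]
  abel

variable [CompleteSpace E] [IsManifold I ∞ M]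

/-- The derivatives of f along Y and along JY each occur twice with opposite signs. As the first
term carries J² rather than -1, the equation J² = -1 plays no role. -/
theorem nijenhuis_tensorialAt_left
    (hJ : ∀ X, MDiffField I X x → MDiffField I (fun y ↦ J y (X y)) x) :
    TensorialAt I E (fun X ↦ nijenhuis I J X Y x) x where
  smul := by
    intro f X hf hX
    have : IsManifold I 2 M := inferInstance
    have e : (fun y ↦ J y ((f • X) y)) = f • fun y ↦ J y (X y) := by
      ext y; simp
    simp only [nijenhuis, e]
    rw [mlieBracket_smul_left hf hX, mlieBracket_smul_left hf hX,
      mlieBracket_smul_left hf (hJ X hX), mlieBracket_smul_left hf (hJ X hX)]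
    simp only [map_add, map_smul]
    module
  add := by
    intro X X' hX hX'
    have : IsManifold I 2 M := inferInstance
    have e : (fun y ↦ J y ((X + X') y)) = (fun y ↦ J y (X y)) + fun y ↦ J y (X' y) := by
      ext y; simp
    simp only [nijenhuis, e]
    rw [mlieBracket_add_left hX hX', mlieBracket_add_left hX hX',
      mlieBracket_add_left (hJ X hX) (hJ X' hX'), mlieBracket_add_left (hJ X hX) (hJ X' hX')]
    simp only [map_add]
    abel

theorem nijenhuis_tensorialAt_right
    (hJ : ∀ X, MDiffField I X x → MDiffField I (fun y ↦ J y (X y)) x) :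
    TensorialAt I E (fun Y ↦ nijenhuis I J X Y x) x where
  smul := by
    intro f Y hf hY
    rw [nijenhuis_swap, (nijenhuis_tensorialAt_left hJ).smul hf hY, nijenhuis_swap (X := X),
      smul_neg]
  add := by
    intro Y Y' hY hY'
    rw [nijenhuis_swap, (nijenhuis_tensorialAt_left hJ).add hY hY', nijenhuis_swap (X := X),
      nijenhuis_swap (X := X) (Y := Y'), neg_add]

end Nijenhuis

/-! ### Vector fields on `M × ℝ` -/

section Product

variable {E : Type*} [NormedAddCommGroup E] [NormedSpace ℝ E]
  {H : Type*} [TopologicalSpace H] {I : ModelWithCorners ℝ E H}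
  {M : Type*} [TopologicalSpace M] [ChartedSpace H M]
  {X Y : ∀ x : M, TangentSpace I x} {p : M × ℝ}

variable (I) in
/-- The component of a tangent vector of `M × ℝ` along `M`. -/
def hor (p : M × ℝ) : TangentSpace (I.prod 𝓘(ℝ, ℝ)) p →L[ℝ] TangentSpace I p.1 :=
  ContinuousLinearMap.fst ℝ (TangentSpace I p.1) ℝ

variable (I) in
/-- The component of a tangent vector of `M × ℝ` along `ℝ`. -/
def ver (p : M × ℝ) : TangentSpace (I.prod 𝓘(ℝ, ℝ)) p →L[ℝ] ℝ :=
  ContinuousLinearMap.snd ℝ (TangentSpace I p.1) ℝ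

theorem hor_ver_ext {u v : TangentSpace (I.prod 𝓘(ℝ, ℝ)) p} (h : hor I p u = hor I p v)
    (h' : ver I p u = ver I p v) : u = v :=
  Prod.ext h h'

/-- The vector field `V + a ∂/∂t` on `M × ℝ`. -/
def prodField (V : ∀ p : M × ℝ, TangentSpace I p.1) (a : M × ℝ → ℝ) (p : M × ℝ) :
    TangentSpace (I.prod 𝓘(ℝ, ℝ)) p :=
  (V p, a p)

/-- The vector field on `M × ℝ` tangent to the slices and induced by a vector field on `M`. -/
def lift (X : ∀ x : M, TangentSpace I x) : ∀ p : M × ℝ, TangentSpace (I.prod 𝓘(ℝ, ℝ)) p :=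
  prodField (fun p ↦ X p.1) (fun _ ↦ 0)

variable (I) in
/-- The vector field `∂/∂t` on `M × ℝ`. -/
def dt : ∀ p : M × ℝ, TangentSpace (I.prod 𝓘(ℝ, ℝ)) p :=
  prodField (fun _ ↦ 0) (fun _ ↦ 1)

@[simp] theorem hor_lift (p : M × ℝ) : hor I p (lift X p) = X p.1 := rfl

@[simp] theorem ver_lift (p : M × ℝ) : ver I p (lift X p) = 0 := rfl

@[simp] theorem hor_dt (p : M × ℝ) : hor I p (dt I p) = 0 := rfl

@[simp] theorem ver_dt (p : M × ℝ) : ver I p (dt I p) = 1 := rfl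

theorem contMDiff_real_tangent {a : M × ℝ → ℝ} (ha : ContMDiff (I.prod 𝓘(ℝ, ℝ)) 𝓘(ℝ, ℝ) ∞ a) :
    ContMDiff (I.prod 𝓘(ℝ, ℝ)) 𝓘(ℝ, ℝ).tangent ∞
      (fun p : M × ℝ ↦ (⟨p.2, a p⟩ : TangentBundle 𝓘(ℝ, ℝ) ℝ)) := by
  intro p
  rw [contMDiffAt_totalSpace]
  refine ⟨contMDiff_snd.contMDiffAt, ?_⟩
  simpa using ha p

theorem mdifferentiableAt_real_tangent {a : M × ℝ → ℝ}
    (ha : MDifferentiableAt (I.prod 𝓘(ℝ, ℝ)) 𝓘(ℝ, ℝ) a p) :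
    MDifferentiableAt (I.prod 𝓘(ℝ, ℝ)) 𝓘(ℝ, ℝ).tangent
      (fun p : M × ℝ ↦ (⟨p.2, a p⟩ : TangentBundle 𝓘(ℝ, ℝ) ℝ)) p := by
  rw [mdifferentiableAt_totalSpace]
  refine ⟨mdifferentiableAt_snd, ?_⟩
  simpa using ha

theorem mvfderiv_comp_fst {f : M → ℝ} (hf : ContMDiff I 𝓘(ℝ, ℝ) ∞ f)
    (v : TangentSpace (I.prod 𝓘(ℝ, ℝ)) p) :
    mvfderiv (I.prod 𝓘(ℝ, ℝ)) (fun q : M × ℝ ↦ f q.1) p v = mvfderiv I f p.1 (hor I p v) := by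
  have h := mvfderiv_comp_apply (f := (Prod.fst : M × ℝ → M)) (g := f) p
    (hf.mdifferentiableAt (by simp)) (mdifferentiableAt_fst (I := I) (I' := 𝓘(ℝ, ℝ))) v
  rw [mfderiv_fst] at h
  exact h

theorem mvfderiv_snd (v : TangentSpace (I.prod 𝓘(ℝ, ℝ)) p) :
    mvfderiv (I.prod 𝓘(ℝ, ℝ)) (fun q : M × ℝ ↦ q.2) p v = ver I p v := by
  have : mfderiv (I.prod 𝓘(ℝ, ℝ)) 𝓘(ℝ, ℝ) (fun q : M × ℝ ↦ q.2) p = _ := mfderiv_snd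
  rw [mvfderiv, this]
  rfl

variable [IsManifold I ∞ M]

theorem isSmoothField_prodField {V : ∀ p : M × ℝ, TangentSpace I p.1} {a : M × ℝ → ℝ}
    (hV : ContMDiff (I.prod 𝓘(ℝ, ℝ)) I.tangent ∞
      (fun p : M × ℝ ↦ (⟨p.1, V p⟩ : TangentBundle I M)))
    (ha : ContMDiff (I.prod 𝓘(ℝ, ℝ)) 𝓘(ℝ, ℝ) ∞ a) :
    IsSmoothField (I.prod 𝓘(ℝ, ℝ)) (prodField V a) :=
  have : IsManifold I 1 M := inferInstance
  contMDiff_equivTangentBundleProd_symm.comp (hV.prodMk (contMDiff_real_tangent ha))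

theorem mdiffField_prodField {V : ∀ p : M × ℝ, TangentSpace I p.1} {a : M × ℝ → ℝ}
    (hV : MDifferentiableAt (I.prod 𝓘(ℝ, ℝ)) I.tangent
      (fun p : M × ℝ ↦ (⟨p.1, V p⟩ : TangentBundle I M)) p)
    (ha : MDifferentiableAt (I.prod 𝓘(ℝ, ℝ)) 𝓘(ℝ, ℝ) a p) :
    MDiffField (I.prod 𝓘(ℝ, ℝ)) (prodField V a) p :=
  have : IsManifold I 1 M := inferInstance
  (contMDiff_equivTangentBundleProd_symm (n := 1).mdifferentiableAt one_ne_zero).comp p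
    (hV.prodMk (mdifferentiableAt_real_tangent ha))

theorem mdifferentiableAt_hor {U : ∀ p : M × ℝ, TangentSpace (I.prod 𝓘(ℝ, ℝ)) p}
    (hU : MDiffField (I.prod 𝓘(ℝ, ℝ)) U p) :
    MDifferentiableAt (I.prod 𝓘(ℝ, ℝ)) I.tangent
      (fun p : M × ℝ ↦ (⟨p.1, hor I p (U p)⟩ : TangentBundle I M)) p :=
  have : IsManifold I 1 M := inferInstance
  mdifferentiableAt_fst.comp p
    (((contMDiff_equivTangentBundleProd (I := I) (I' := 𝓘(ℝ, ℝ)) (M := M) (M' := ℝ)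
      (n := 1)).mdifferentiableAt one_ne_zero).comp p hU)

theorem mdifferentiableAt_ver {U : ∀ p : M × ℝ, TangentSpace (I.prod 𝓘(ℝ, ℝ)) p}
    (hU : MDiffField (I.prod 𝓘(ℝ, ℝ)) U p) :
    MDifferentiableAt (I.prod 𝓘(ℝ, ℝ)) 𝓘(ℝ, ℝ) (fun p : M × ℝ ↦ ver I p (U p)) p :=
  have : IsManifold I 1 M := inferInstance
  ((contMDiff_snd_tangentBundle_modelSpace ℝ 𝓘(ℝ, ℝ) (n := 1)).mdifferentiableAt one_ne_zero).comp p
    (mdifferentiableAt_snd.comp p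
    (((contMDiff_equivTangentBundleProd (I := I) (I' := 𝓘(ℝ, ℝ)) (M := M) (M' := ℝ)
      (n := 1)).mdifferentiableAt one_ne_zero).comp p hU))

theorem isSmoothField_lift (hX : IsSmoothField I X) :
    IsSmoothField (I.prod 𝓘(ℝ, ℝ)) (lift X) :=
  isSmoothField_prodField (hX.comp contMDiff_fst) contMDiff_const

theorem isSmoothField_dt : IsSmoothField (I.prod 𝓘(ℝ, ℝ)) (dt I (M := M)) :=
  isSmoothField_prodField (isSmoothField_zero.comp contMDiff_fst) contMDiff_const

variable [FiniteDimensional ℝ E] [T2Space M]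

/-- A tangent vector of M × ℝ is determined by its action on functions pulled back from M and on the
coordinate t, and on these the bracket acts as a commutator. -/
theorem mlieBracket_lift_lift (hX : IsSmoothField I X) (hY : IsSmoothField I Y) (p : M × ℝ) :
    mlieBracket (I.prod 𝓘(ℝ, ℝ)) (lift X) (lift Y) p = lift (mlieBracket I X Y) p := by
  have hX' := isSmoothField_lift hX
  have hY' := isSmoothField_lift hY
  refine hor_ver_ext ?_ ?_
  · rw [← sub_eq_zero]
    refine eq_zero_of_mvfderiv_eq_zero fun f hf ↦ ?_
    have h := mvfderiv_mlieBracket hX' hY' (f := fun q : M × ℝ ↦ f q.1)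
      (hf.comp contMDiff_fst) p
    simp only [mvfderiv_comp_fst hf, hor_lift] at h
    rw [mvfderiv_comp_fst (hY.mvfderiv hf), mvfderiv_comp_fst (hX.mvfderiv hf)] at h
    rw [map_sub, hor_lift, mvfderiv_mlieBracket hX hY hf, h, hor_lift, hor_lift, sub_self]
  · have h := mvfderiv_mlieBracket hX' hY' (f := fun q : M × ℝ ↦ q.2) contMDiff_snd p
    simp only [mvfderiv_snd, ver_lift, mvfderiv_const, zero_apply, sub_zero] at h
    exact h

theorem mlieBracket_lift_dt (hX : IsSmoothField I X) (p : M × ℝ) :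
    mlieBracket (I.prod 𝓘(ℝ, ℝ)) (lift X) (dt I) p = 0 := by
  have hX' := isSmoothField_lift hX
  have hdt := isSmoothField_dt (I := I) (M := M)
  refine hor_ver_ext ?_ ?_
  · rw [map_zero]
    refine eq_zero_of_mvfderiv_eq_zero fun f hf ↦ ?_
    have h := mvfderiv_mlieBracket hX' hdt (f := fun q : M × ℝ ↦ f q.1) (hf.comp contMDiff_fst) p
    simp only [mvfderiv_comp_fst hf, hor_lift, hor_dt, map_zero] at h
    rw [mvfderiv_comp_fst (hX.mvfderiv hf), mvfderiv_const] at h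
    simpa using h
  · have h := mvfderiv_mlieBracket hX' hdt (f := fun q : M × ℝ ↦ q.2) contMDiff_snd p
    simp only [mvfderiv_snd, ver_lift, ver_dt, mvfderiv_const, zero_apply, sub_zero] at h
    rw [h, map_zero]

end Product

namespace AlmostContactMetric

/-! ### Normality -/

section Normal

variable {n : ℕ} {M : Type*} [TopologicalSpace M]
  [ChartedSpace (EuclideanSpace ℝ (Fin (2 * n + 1))) M] [IsManifold (𝓡 (2 * n + 1)) ∞ M]
  (S : AlmostContactMetric n M) {p : M × ℝ}
  {X Y : ∀ x : M, TangentSpace (𝓡 (2 * n + 1)) x}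

theorem hor_coneJ (v : TangentSpace ((𝓡 (2 * n + 1)).prod 𝓘(ℝ, ℝ)) p) :
    hor (𝓡 (2 * n + 1)) p (S.coneJ p v)
      = S.φ p.1 (hor (𝓡 (2 * n + 1)) p v) + ver (𝓡 (2 * n + 1)) p v • S.ξ p.1 := rfl

theorem ver_coneJ (v : TangentSpace ((𝓡 (2 * n + 1)).prod 𝓘(ℝ, ℝ)) p) :
    ver (𝓡 (2 * n + 1)) p (S.coneJ p v) = -S.η p.1 (hor (𝓡 (2 * n + 1)) p v) := rfl

/-- The differentiability of JU required for the tensoriality of the torsion. -/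
theorem mdiffField_coneJ (U : ∀ p : M × ℝ, TangentSpace ((𝓡 (2 * n + 1)).prod 𝓘(ℝ, ℝ)) p)
    (hU : MDiffField ((𝓡 (2 * n + 1)).prod 𝓘(ℝ, ℝ)) U p) :
    MDiffField ((𝓡 (2 * n + 1)).prod 𝓘(ℝ, ℝ)) (fun q ↦ S.coneJ q (U q)) p := by
  have hφ : MDifferentiableAt ((𝓡 (2 * n + 1)).prod 𝓘(ℝ, ℝ)) (𝓡 (2 * n + 1)).tangent
      (fun q : M × ℝ ↦ (⟨q.1, S.φ q.1 (hor (𝓡 (2 * n + 1)) q (U q))⟩ :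
        TangentBundle (𝓡 (2 * n + 1)) M)) p :=
    MDifferentiableAt.clm_bundle_apply
      ((S.smooth_φ.mdifferentiableAt (by simp)).comp p mdifferentiableAt_fst)
      (mdifferentiableAt_hor hU)
  have hη : MDifferentiableAt ((𝓡 (2 * n + 1)).prod 𝓘(ℝ, ℝ)) 𝓘(ℝ, ℝ)
      (fun q : M × ℝ ↦ S.η q.1 (hor (𝓡 (2 * n + 1)) q (U q))) p := by
    have h : MDifferentiableAt ((𝓡 (2 * n + 1)).prod 𝓘(ℝ, ℝ)) ((𝓡 (2 * n + 1)).prod 𝓘(ℝ, ℝ))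
        (fun q : M × ℝ ↦ TotalSpace.mk' ℝ (E := Bundle.Trivial M ℝ) q.1
          (S.η q.1 (hor (𝓡 (2 * n + 1)) q (U q)))) p :=
      MDifferentiableAt.clm_bundle_apply
        ((S.smooth_η.mdifferentiableAt (by simp)).comp p mdifferentiableAt_fst)
        (mdifferentiableAt_hor hU)
    rw [mdifferentiableAt_totalSpace] at h
    exact h.2
  have e : (fun q ↦ S.coneJ q (U q))
      = prodField (fun q ↦ S.φ q.1 (hor (𝓡 (2 * n + 1)) q (U q)))
          (fun q ↦ -S.η q.1 (hor (𝓡 (2 * n + 1)) q (U q)))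
        + (fun q ↦ ver (𝓡 (2 * n + 1)) q (U q)) • lift S.ξ := by
    ext q : 1
    refine hor_ver_ext ?_ ?_
    · rfl
    · rw [ver_coneJ]
      change _ = -S.η q.1 (hor (𝓡 (2 * n + 1)) q (U q)) + ver (𝓡 (2 * n + 1)) q (U q) * 0
      ring
  rw [e]
  exact mdifferentiableAt_add_section (mdiffField_prodField hφ hη.neg)
    ((mdifferentiableAt_ver hU).smul_section ((isSmoothField_lift S.smooth_ξ).mdiffAt p))

theorem coneJ_lift (X : ∀ x : M, TangentSpace (𝓡 (2 * n + 1)) x) :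
    (fun q : M × ℝ ↦ S.coneJ q (lift X q))
      = lift (S.φField X) + (fun q : M × ℝ ↦ -S.ηFun X q.1) • dt (𝓡 (2 * n + 1)) := by
  ext q : 1
  refine hor_ver_ext ?_ ?_
  · simp [hor_coneJ, φField]
  · simp [ver_coneJ, ηFun]

theorem coneJ_dt :
    (fun q : M × ℝ ↦ S.coneJ q (dt (𝓡 (2 * n + 1)) q)) = lift S.ξ := by
  ext q : 1
  refine hor_ver_ext ?_ ?_
  · simp [hor_coneJ]
  · simp [ver_coneJ]

theorem coneJ_coneJ (v : TangentSpace ((𝓡 (2 * n + 1)).prod 𝓘(ℝ, ℝ)) p) :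
    S.coneJ p (S.coneJ p v) = -v := by
  refine hor_ver_ext ?_ ?_
  · simp only [hor_coneJ, ver_coneJ, map_add, map_smul, map_neg, S.φ_φ, S.φ_ξ]
    module
  · simp only [hor_coneJ, ver_coneJ, map_add, map_smul, map_neg, S.η_φ, S.η_ξ, smul_eq_mul]
    ring

variable [T2Space M]

theorem mlieBracket_dt_lift (hX : IsSmoothField (𝓡 (2 * n + 1)) X) (p : M × ℝ) :
    mlieBracket ((𝓡 (2 * n + 1)).prod 𝓘(ℝ, ℝ)) (dt (𝓡 (2 * n + 1))) (lift X) p = 0 := by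
  rw [mlieBracket_swap_apply, mlieBracket_lift_dt hX, neg_zero]

/-- The Lie bracket of `X + f ∂/∂t` and `Y + h ∂/∂t`, for vector fields and functions on `M`. -/
theorem mlieBracket_lift_add_smul_dt {f h : M → ℝ} (hX : IsSmoothField (𝓡 (2 * n + 1)) X)
    (hY : IsSmoothField (𝓡 (2 * n + 1)) Y) (hf : ContMDiff (𝓡 (2 * n + 1)) 𝓘(ℝ, ℝ) ∞ f)
    (hh : ContMDiff (𝓡 (2 * n + 1)) 𝓘(ℝ, ℝ) ∞ h) (p : M × ℝ) :
    mlieBracket ((𝓡 (2 * n + 1)).prod 𝓘(ℝ, ℝ))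
        (lift X + (fun q : M × ℝ ↦ f q.1) • dt (𝓡 (2 * n + 1)))
        (lift Y + (fun q : M × ℝ ↦ h q.1) • dt (𝓡 (2 * n + 1))) p
      = lift (mlieBracket (𝓡 (2 * n + 1)) X Y) p
        + (mvfderiv (𝓡 (2 * n + 1)) h p.1 (X p.1) - mvfderiv (𝓡 (2 * n + 1)) f p.1 (Y p.1))
          • dt (𝓡 (2 * n + 1)) p := by
  have hX' := (isSmoothField_lift hX).mdiffAt p
  have hY' := (isSmoothField_lift hY).mdiffAt p
  have hdt := (isSmoothField_dt (I := 𝓡 (2 * n + 1)) (M := M)).mdiffAt p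
  have hf' : MDifferentiableAt ((𝓡 (2 * n + 1)).prod 𝓘(ℝ, ℝ)) 𝓘(ℝ, ℝ)
      (fun q : M × ℝ ↦ f q.1) p := (hf.comp contMDiff_fst).mdifferentiableAt (by simp)
  have hh' : MDifferentiableAt ((𝓡 (2 * n + 1)).prod 𝓘(ℝ, ℝ)) 𝓘(ℝ, ℝ)
      (fun q : M × ℝ ↦ h q.1) p := (hh.comp contMDiff_fst).mdifferentiableAt (by simp)
  have : IsManifold ((𝓡 (2 * n + 1)).prod 𝓘(ℝ, ℝ)) 2 (M × ℝ) := inferInstance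
  rw [mlieBracket_add_left hX' (hf'.smul_section hdt),
    mlieBracket_add_right hY' (hh'.smul_section hdt),
    mlieBracket_add_right hY' (hh'.smul_section hdt),
    mlieBracket_smul_right hh' hdt, mlieBracket_smul_left hf' hdt, mlieBracket_smul_left hf' hdt,
    mlieBracket_smul_right hh' hdt, mlieBracket_lift_lift hX hY, mlieBracket_lift_dt hX,
    mlieBracket_dt_lift hY, mlieBracket_self, mvfderiv_comp_fst hf, mvfderiv_comp_fst hf,
    mvfderiv_comp_fst hh, mvfderiv_comp_fst hh]
  simp only [hor_lift, Pi.smul_apply', hor_dt, map_smul, map_zero, Pi.zero_apply, smul_zero]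
  module

theorem mlieBracket_lift_add_smul_dt_lift {f : M → ℝ} (hX : IsSmoothField (𝓡 (2 * n + 1)) X)
    (hY : IsSmoothField (𝓡 (2 * n + 1)) Y) (hf : ContMDiff (𝓡 (2 * n + 1)) 𝓘(ℝ, ℝ) ∞ f)
    (p : M × ℝ) :
    mlieBracket ((𝓡 (2 * n + 1)).prod 𝓘(ℝ, ℝ))
        (lift X + (fun q : M × ℝ ↦ f q.1) • dt (𝓡 (2 * n + 1))) (lift Y) p
      = lift (mlieBracket (𝓡 (2 * n + 1)) X Y) p
        + (-mvfderiv (𝓡 (2 * n + 1)) f p.1 (Y p.1)) • dt (𝓡 (2 * n + 1)) p := by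
  have h := mlieBracket_lift_add_smul_dt hX hY hf (h := fun _ ↦ 0) contMDiff_const p
  have e : lift Y + (fun _ : M × ℝ ↦ (0 : ℝ)) • dt (𝓡 (2 * n + 1)) = lift Y := by
    ext q : 1; simp
  rw [e, mvfderiv_const] at h
  simpa using h

variable {S}

/-- Brackets become differences of covariant derivatives. The terms in ∇X and ∇Y cancel, and what is
left is algebraic in ∇φ and ∇ξ and cancels once their formulas are inserted. -/
theorem nijenhuis_lift_lift
    (hφ : ∀ (x : M) (w v : TangentSpace (𝓡 (2 * n + 1)) x),
      S.covφ x w v = S.g.inner x w v • S.ξ x - S.η x w • v)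
    (hB : ∀ (x : M) (v : TangentSpace (𝓡 (2 * n + 1)) x), S.nablaξ x v = -S.φ x v)
    (hX : IsSmoothField (𝓡 (2 * n + 1)) X) (hY : IsSmoothField (𝓡 (2 * n + 1)) Y) (p : M × ℝ) :
    nijenhuis ((𝓡 (2 * n + 1)).prod 𝓘(ℝ, ℝ)) S.coneJ (lift X) (lift Y) p = 0 := by
  have hφX := S.isSmoothField_φField hX
  have hφY := S.isSmoothField_φField hY
  have hηX := S.contMDiff_ηFun hX
  have hηY := S.contMDiff_ηFun hY
  have hm {X : ∀ x : M, TangentSpace (𝓡 (2 * n + 1)) x} (hX : IsSmoothField (𝓡 (2 * n + 1)) X) :=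
    hX.mdiffAt p.1
  have dneg (f : M → ℝ) : mvfderiv (𝓡 (2 * n + 1)) (fun y ↦ -f y) p.1
      = -mvfderiv (𝓡 (2 * n + 1)) f p.1 := mvfderiv_neg
  have hswap : mlieBracket ((𝓡 (2 * n + 1)).prod 𝓘(ℝ, ℝ)) (lift X)
      (lift (S.φField Y) + (fun q : M × ℝ ↦ -S.ηFun Y q.1) • dt (𝓡 (2 * n + 1))) p
      = -(lift (mlieBracket (𝓡 (2 * n + 1)) (S.φField Y) X) p
        + (mvfderiv (𝓡 (2 * n + 1)) (S.ηFun Y) p.1 (X p.1)) • dt (𝓡 (2 * n + 1)) p) := by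
    rw [mlieBracket_swap_apply,
      mlieBracket_lift_add_smul_dt_lift hφY hX (f := fun y ↦ -S.ηFun Y y) hηY.neg, dneg]
    simp
  rw [nijenhuis, S.coneJ_lift, S.coneJ_lift, S.coneJ_coneJ, hswap,
    mlieBracket_lift_add_smul_dt hφX hφY (f := fun y ↦ -S.ηFun X y) (h := fun y ↦ -S.ηFun Y y)
      hηX.neg hηY.neg,
    mlieBracket_lift_add_smul_dt_lift hφX hY (f := fun y ↦ -S.ηFun X y) hηX.neg,
    mlieBracket_lift_lift hX hY, dneg, dneg]
  have e₁ : S.g.inner p.1 (S.φ p.1 (X p.1)) (Y p.1) = -S.g.inner p.1 (X p.1) (S.φ p.1 (Y p.1)) :=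
    S.inner_φ_left _ _
  have e₂ : S.g.inner p.1 (S.φ p.1 (Y p.1)) (X p.1) = S.g.inner p.1 (X p.1) (S.φ p.1 (Y p.1)) :=
    S.g.symm _ _ _
  have e₃ : S.g.inner p.1 (Y p.1) (S.φ p.1 (X p.1)) = -S.g.inner p.1 (X p.1) (S.φ p.1 (Y p.1)) := by
    rw [S.g.symm, e₁]
  have e₄ : S.g.inner p.1 (Y p.1) (X p.1) = S.g.inner p.1 (X p.1) (Y p.1) := S.g.symm _ _ _
  refine hor_ver_ext ?_ ?_
  · simp only [map_add, map_sub, map_neg, map_smul, hor_coneJ, hor_lift, hor_dt,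
      ver_lift, ver_dt, S.mvfderiv_ηFun (hm hX), S.mvfderiv_ηFun (hm hY), neg_apply,
      ← nabla_sub_nabla S.g (hm hX) (hm hY), ← nabla_sub_nabla S.g (hm hφX) (hm hφY),
      ← nabla_sub_nabla S.g (hm hφX) (hm hY), ← nabla_sub_nabla S.g (hm hφY) (hm hX),
      S.nabla_φField (hm hX), S.nabla_φField (hm hY), hφ, hB]
    simp only [φField, S.φ_φ, S.φ_ξ, map_zero, smul_zero, e₁, e₂, e₃, e₄]
    module
  · simp only [map_add, map_sub, map_neg, map_smul, ver_coneJ, hor_lift, hor_dt,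
      ver_lift, ver_dt, S.mvfderiv_ηFun (hm hX), S.mvfderiv_ηFun (hm hY), neg_apply,
      ← nabla_sub_nabla S.g (hm hφX) (hm hY), ← nabla_sub_nabla S.g (hm hφY) (hm hX),
      S.nabla_φField (hm hX), S.nabla_φField (hm hY), hφ, hB]
    simp only [φField, S.φ_φ, S.η_φ, S.η_ξ, smul_eq_mul, map_zero, map_add, map_neg, map_smul,
      add_apply, neg_apply, smul_apply, S.inner_ξ_left, e₁, e₂, e₄]
    ring

/-- Here the torsion is [JX, ξ] - J[X, ξ], with components -(L_ξ φ)X and (L_ξ η)(X). Both vanish by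
∇_ξ φ = 0 and ∇ξ = -φ, without the full formula for ∇φ. -/
theorem nijenhuis_lift_dt (hS : S.IsContactMetric)
    (hB : ∀ (x : M) (v : TangentSpace (𝓡 (2 * n + 1)) x), S.nablaξ x v = -S.φ x v)
    (hX : IsSmoothField (𝓡 (2 * n + 1)) X) (p : M × ℝ) :
    nijenhuis ((𝓡 (2 * n + 1)).prod 𝓘(ℝ, ℝ)) S.coneJ (lift X) (dt (𝓡 (2 * n + 1))) p = 0 := by
  have hφX := S.isSmoothField_φField hX
  have hηX := S.contMDiff_ηFun hX
  have hm {X : ∀ x : M, TangentSpace (𝓡 (2 * n + 1)) x} (hX : IsSmoothField (𝓡 (2 * n + 1)) X) :=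
    hX.mdiffAt p.1
  have hdt : mlieBracket ((𝓡 (2 * n + 1)).prod 𝓘(ℝ, ℝ))
      (lift (S.φField X) + (fun q : M × ℝ ↦ -S.ηFun X q.1) • dt (𝓡 (2 * n + 1)))
      (dt (𝓡 (2 * n + 1))) p = 0 := by
    have h := mlieBracket_lift_add_smul_dt hφX isSmoothField_zero (f := fun y ↦ -S.ηFun X y)
      (h := fun _ ↦ 1) hηX.neg contMDiff_const p
    -- ∂/∂t is written as 0 + 1·∂/∂t so that the general bracket formula applies; η(X) does not
    -- depend on t.
    have e : lift (0 : ∀ x : M, TangentSpace (𝓡 (2 * n + 1)) x)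
        + (fun _ : M × ℝ ↦ (1 : ℝ)) • dt (𝓡 (2 * n + 1)) = dt (𝓡 (2 * n + 1)) := by
      ext q : 1
      refine hor_ver_ext ?_ ?_ <;> simp
    rw [e, mvfderiv_const, mlieBracket_zero_right] at h
    rw [h]
    refine hor_ver_ext ?_ ?_ <;> simp
  have dneg (f : M → ℝ) : mvfderiv (𝓡 (2 * n + 1)) (fun y ↦ -f y) p.1
      = -mvfderiv (𝓡 (2 * n + 1)) f p.1 := mvfderiv_neg
  have h0 : nabla S.g S.ξ p.1 (X p.1) = -S.φ p.1 (X p.1) := hB _ _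
  have h1 : nabla S.g S.ξ p.1 (S.φField X p.1) = -S.φ p.1 (S.φ p.1 (X p.1)) := hB _ _
  rw [nijenhuis, S.coneJ_lift, S.coneJ_dt, hdt, mlieBracket_lift_dt hX,
    mlieBracket_lift_lift hX S.smooth_ξ,
    mlieBracket_lift_add_smul_dt_lift hφX S.smooth_ξ (f := fun y ↦ -S.ηFun X y) hηX.neg, dneg]
  refine hor_ver_ext ?_ ?_
  · simp only [map_add, map_sub, map_neg, map_smul, hor_coneJ, hor_lift, hor_dt,
      ver_lift, ← nabla_sub_nabla S.g (hm hφX) (hm S.smooth_ξ),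
      ← nabla_sub_nabla S.g (hm hX) (hm S.smooth_ξ), h0, h1, nabla_φField_ξ hS (hm hX), map_zero]
    module
  · simp only [map_add, map_sub, map_neg, map_smul, ver_coneJ, hor_lift, ver_dt,
      ver_lift, ← nabla_sub_nabla S.g (hm hX) (hm S.smooth_ξ), h0, S.η_φ, map_zero,
      S.mvfderiv_ηFun (hm hX), nablaξ_ξ hS, neg_apply, zero_apply, smul_eq_mul]
    ring

theorem nijenhuis_dt_dt (p : M × ℝ) :
    nijenhuis ((𝓡 (2 * n + 1)).prod 𝓘(ℝ, ℝ)) S.coneJ (dt (𝓡 (2 * n + 1)))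
      (dt (𝓡 (2 * n + 1))) p = 0 := by
  rw [nijenhuis, S.coneJ_dt, mlieBracket_lift_dt S.smooth_ξ, mlieBracket_dt_lift S.smooth_ξ]
  simp

/-- The torsion at p sees only the values of the fields at p, so each may be replaced by a lifted
field plus a constant multiple of ∂/∂t; bilinearity then leaves the cases already computed. -/
theorem isNormal_of_covφ (hS : S.IsContactMetric)
    (hφ : ∀ (x : M) (w v : TangentSpace (𝓡 (2 * n + 1)) x),
      S.covφ x w v = S.g.inner x w v • S.ξ x - S.η x w • v)
    (hB : ∀ (x : M) (v : TangentSpace (𝓡 (2 * n + 1)) x), S.nablaξ x v = -S.φ x v) :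
    S.IsNormal := by
  intro U V hU hV p
  have : IsManifold ((𝓡 (2 * n + 1)).prod 𝓘(ℝ, ℝ)) 1 (M × ℝ) := inferInstance
  have hJ := S.mdiffField_coneJ (p := p)
  obtain ⟨X, hX, hXp⟩ := exists_isSmoothField (I := 𝓡 (2 * n + 1)) p.1 (hor _ p (U p))
  obtain ⟨Y, hY, hYp⟩ := exists_isSmoothField (I := 𝓡 (2 * n + 1)) p.1 (hor _ p (V p))
  have hdt := (isSmoothField_dt (I := 𝓡 (2 * n + 1)) (M := M)).mdiffAt p
  have hX' := (isSmoothField_lift hX).mdiffAt p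
  have hY' := (isSmoothField_lift hY).mdiffAt p
  have ha (a : ℝ) : MDifferentiableAt ((𝓡 (2 * n + 1)).prod 𝓘(ℝ, ℝ)) 𝓘(ℝ, ℝ)
      (fun _ : M × ℝ ↦ a) p := mdifferentiableAt_const
  have hadt (a : ℝ) := (ha a).smul_section hdt
  let U' : ∀ q : M × ℝ, TangentSpace ((𝓡 (2 * n + 1)).prod 𝓘(ℝ, ℝ)) q :=
    lift X + (fun _ : M × ℝ ↦ ver (𝓡 (2 * n + 1)) p (U p)) • dt (𝓡 (2 * n + 1))
  let V' : ∀ q : M × ℝ, TangentSpace ((𝓡 (2 * n + 1)).prod 𝓘(ℝ, ℝ)) q :=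
    lift Y + (fun _ : M × ℝ ↦ ver (𝓡 (2 * n + 1)) p (V p)) • dt (𝓡 (2 * n + 1))
  have eU : U p = U' p := by
    refine hor_ver_ext ?_ ?_ <;> simp [U', hXp]
  have eV : V p = V' p := by
    refine hor_ver_ext ?_ ?_ <;> simp [V', hYp]
  have key := TensorialAt.pointwise₂ (Φ := fun U V ↦ nijenhuis _ S.coneJ U V p)
    (fun _ _ ↦ nijenhuis_tensorialAt_left hJ) (fun _ _ ↦ nijenhuis_tensorialAt_right hJ)
    (hU.mdiffAt p) (mdifferentiableAt_add_section hX' (hadt _))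
    (hV.mdiffAt p) (mdifferentiableAt_add_section hY' (hadt _)) eU eV
  rw [key, (nijenhuis_tensorialAt_left hJ).add hX' (hadt _), (nijenhuis_tensorialAt_left hJ).smul (ha _) hdt,
    (nijenhuis_tensorialAt_right hJ).add hY' (hadt _), (nijenhuis_tensorialAt_right hJ).add hY' (hadt _),
    (nijenhuis_tensorialAt_right hJ).smul (ha _) hdt, (nijenhuis_tensorialAt_right hJ).smul (ha _) hdt,
    nijenhuis_lift_lift hφ hB hX hY, nijenhuis_lift_dt hS hB hX, nijenhuis_dt_dt,
    nijenhuis_swap (Y := lift Y), nijenhuis_lift_dt hS hB hY]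
  simp

end Normal

end AlmostContactMetric

end ContactGeometry

end

/-- A contact metric manifold that satisfies one of the identities `(G₁)`, `(G₂)`, `(G₃)` is
Sasakian. -/
theorem corollary2 (n : ℕ) (M : Type*) [TopologicalSpace M] [T2Space M]
    [SecondCountableTopology M] [ChartedSpace (EuclideanSpace ℝ (Fin (2 * n + 1))) M]
    [IsManifold (𝓡 (2 * n + 1)) ∞ M] (S : ContactGeometry.AlmostContactMetric n M)
    (hS : S.IsContactMetric) (hG : S.SatisfiesG₁ ∨ S.SatisfiesG₂ ∨ S.SatisfiesG₃) :
    S.IsSasakian :=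
  ⟨hS, ContactGeometry.AlmostContactMetric.isNormal_of_covφ hS
    (fun _ ↦ ContactGeometry.AlmostContactMetric.covφ_eq_of_curvature hS hG)
    (ContactGeometry.AlmostContactMetric.nablaξ_eq_of_curvature hS hG)⟩
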